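/- Let $X$ be a connected simple graph (possibly infinite, not necessarily locally finite) with vertex set $VX$ and edge set $EX$, and let $c : EX \to \{1,2,\dots\}$. For $A \subseteq VX$ write $A^* = VX \setminus A$ and let $\delta A$ be the set of edges with one vertex in $A$ and one in $A^*$. A cut is a set $A\subseteq VX$ with $\delta A$ finite ($\emptyset$ and $VX$ are allowed); its capacity is $c(A)=\sum_{e\in\delta A}c(e)$. The cuts form a Boolean ring $\mathcal B X$ (symmetric difference and intersection, unit $VX$). Let $\mathcal B_nX$ be the subring generated by the cuts of capacity at most $n$. A ray is a sequence of distinct vertices $x_1,x_2,\dots$ with $x_i,x_{i+1}$ adjacent for all $i$; two rays $(x_i),(x_i')$ are equivalent if there is no cut $A$ such that, for all large $i$, exactly one of $x_i, x_i'$ is in $A$. The set $\Omega X$ of ends is the set of equivalence classes of rays. A vertex lies in $A$ if it belongs to $A$, and an end lies in $A$ if every ray representing it is eventually in $A$. A cut $A$ separates $u,v\in VX\cup\Omega X$ if one of them lies in $A$ and the other in $A^*$. It is thin with respect to $u,v$ if it separates $u,v$ and $c(A)$ is minimal among the cuts separating $u,v$; it is thin if it is thin with respect to some pair $u,v$. Two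 cuts $A,B$ are nested if one of $A\cap B$, $A^*\cap B$, $A\cap B^*$, $A^*\cap B^*$ is empty. For a set $\mathcal C$ of cuts, let $\mu(A,\mathcal C)$ be the number of members of $\mathcal C$ that are not nested with $A$. Let $\mathcal C_n$ be the set of thin cuts of capacity $n$. Put $\mathcal E_0=\emptyset$, $\mathcal E_1=\mathcal C_1$, and for $n\ge 2$ put $\mathcal D_n=\{A\in\mathcal C_n : \mu(A,\mathcal E_{n-1})=0\}$ and $\mathcal E_n=\mathcal E_{n-1}\cup\mathcal D_n'$, where $\mathcal D_n'$ consists of those $D\in\mathcal D_n$ for which there are $u,v\in VX\cup\Omega X$ such that $D$ is thin with respect to $u,v$ and $\mu(D,\mathcal D_n)$ is minimal among all members of $\mathcal D_n$ that are thin with respect to $u,v$. Let $\mathcal E=\bigcup_n\mathcal E_n$. For a set $\mathcal F$ of cuts and $A\in\mathcal F$, let $\iota A:\mathcal F\to\{0,1\}$ be the map with $\iota A(B)=1$ if and only if $A\subseteq B$ or $A^*\subsetneq B$. The graph $T(\mathcal F)$ has vertex set $\{\iota A: A\in\mathcal F\}$ (a single vertex if $\mathcal F=\emptyset$), and its edges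 are given by the members of $\mathcal F$, where $A$ joins $\iota A$ to $\tau A=\iota A^*$. **Theorem.** 1. For every $u,v\in VX\cup\Omega X$ that can be separated by a cut, $\mathcal E$ contains a cut that is thin with respect to $u,v$. 2. For every $n\ge 0$, $\mathcal E_n$ generates the Boolean ring $\mathcal B_nX$. 3. For every $n\ge 0$, $\mathcal E_n$ is the directed edge set of a tree: $\mathcal E_n$ is closed under complementation, $T(\mathcal E_n)$ is a tree, and $A\mapsto(\iota A,\tau A)$ is a bijection from $\mathcal E_n$ onto the set of directed edges of $T(\mathcal E_n)$ (thus the reverse of the edge $A$ is $A^*$). -/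

import Mathlib

open Filter

namespace CutTree

variable {V : Type*}

/-- The edges with one vertex in `A` and one vertex in the complement of `A`. -/
def coboundary (G : SimpleGraph V) (A : Set V) : Set G.edgeSet :=
  {e | (∃ x ∈ e.1, x ∈ A) ∧ ∃ y ∈ e.1, y ∉ A}

/-- A cut is a set of vertices with finite coboundary; `∅` and the whole vertex set are allowed. -/
def IsCut (G : SimpleGraph V) (A : Set V) : Prop :=
  (coboundary G A).Finite

/-- The capacity of `A`: the sum of `c e` over the coboundary of `A` (used only for cuts, where
the coboundary is finite). -/
noncomputable def capacity {G : SimpleGraph V} (c : G.edgeSet → ℕ+) (A : Set V) : ℕ :=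
  ∑ᶠ e ∈ coboundary G A, (c e : ℕ)

/-- A ray: an infinite sequence of distinct vertices, consecutive ones being adjacent. -/
structure Ray (G : SimpleGraph V) where
  toFun : ℕ → V
  injective : Function.Injective toFun
  adj : ∀ i, G.Adj (toFun i) (toFun (i + 1))

/-- The set `A` separates two rays: from some index on, their vertices are on opposite sides. -/
def SeparatesRays {G : SimpleGraph V} (A : Set V) (R S : Ray G) : Prop :=
  ∀ᶠ n in atTop, (R.toFun n ∈ A ∧ S.toFun n ∉ A) ∨ (R.toFun n ∉ A ∧ S.toFun n ∈ A)

/-- A ray is eventually on one side of every cut. -/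
theorem Ray.eventually_mem_or {G : SimpleGraph V} {A : Set V} (hA : IsCut G A) (R : Ray G) :
    (∀ᶠ n in atTop, R.toFun n ∈ A) ∨ (∀ᶠ n in atTop, R.toFun n ∉ A) := by
  let f : ℕ → G.edgeSet := fun n => ⟨s(R.toFun n, R.toFun (n + 1)), R.adj n⟩
  have hf : Function.Injective f := by
    intro m n h
    have h' : s(R.toFun m, R.toFun (m + 1)) = s(R.toFun n, R.toFun (n + 1)) :=
      congrArg Subtype.val h
    rcases Sym2.eq_iff.1 h' with ⟨h1, _⟩ | ⟨h1, h2⟩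
    · exact R.injective h1
    · have := R.injective h1
      have := R.injective h2
      omega
  have hfin : (f ⁻¹' coboundary G A).Finite := hA.preimage hf.injOn
  obtain ⟨N, hN⟩ := hfin.bddAbove
  have step : ∀ n, N < n → (R.toFun (n + 1) ∈ A ↔ R.toFun n ∈ A) := by
    intro n hn
    have hnot : f n ∉ coboundary G A := fun h => absurd (hN h) (by omega)
    by_contra hne
    apply hnot
    by_cases h : R.toFun n ∈ A
    · exact ⟨⟨_, Sym2.mem_mk_left _ _, h⟩, ⟨_, Sym2.mem_mk_right _ _, by tauto⟩⟩
    · exact ⟨⟨_, Sym2.mem_mk_right _ _, by tauto⟩, ⟨_, Sym2.mem_mk_left _ _, h⟩⟩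
  have all : ∀ k, (R.toFun (N + 1 + k) ∈ A ↔ R.toFun (N + 1) ∈ A) := by
    intro k
    induction k with
    | zero => rfl
    | succ k ih => exact (step (N + 1 + k) (by omega)).trans ih
  by_cases h : R.toFun (N + 1) ∈ A
  · left
    filter_upwards [eventually_ge_atTop (N + 1)] with n hn
    obtain ⟨k, rfl⟩ := Nat.exists_eq_add_of_le hn
    exact (all k).2 h
  · right
    filter_upwards [eventually_ge_atTop (N + 1)] with n hn
    obtain ⟨k, rfl⟩ := Nat.exists_eq_add_of_le hn
    exact fun h' => h ((all k).1 h')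

/-- Two rays are equivalent when no cut separates them. -/
instance raySetoid (G : SimpleGraph V) : Setoid (Ray G) where
  r R S := ∀ A, IsCut G A → ¬ SeparatesRays A R S
  iseqv := by
    refine ⟨fun R A _ h => ?_, fun {R S} h A hA hs => h A hA ?_, fun {R S T} h1 h2 A hA hs => ?_⟩
    · obtain ⟨n, hn⟩ := h.exists
      tauto
    · filter_upwards [hs] with n hn
      tauto
    · rcases Ray.eventually_mem_or hA R with hR | hR <;>
      rcases Ray.eventually_mem_or hA S with hS | hS
      · refine h2 A hA ?_
        filter_upwards [hs, hR, hS] with n a b c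
        tauto
      · refine h1 A hA ?_
        filter_upwards [hR, hS] with n b c
        tauto
      · refine h1 A hA ?_
        filter_upwards [hR, hS] with n b c
        tauto
      · refine h2 A hA ?_
        filter_upwards [hs, hR, hS] with n a b c
        tauto

/-- The (edge) ends of `G`. -/
def EdgeEnd (G : SimpleGraph V) : Type _ :=
  Quotient (raySetoid G)

/-- A vertex lies in `A` if it is an element of `A`; an end lies in `A` if every ray representing
it is eventually in `A`. -/
def LiesIn {G : SimpleGraph V} (A : Set V) : V ⊕ EdgeEnd G → Prop
  | Sum.inl v => v ∈ A
  | Sum.inr ω => ∀ R : Ray G, Quotient.mk (raySetoid G) R = ω → ∀ᶠ n in atTop, R.toFun n ∈ A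

/-- The set `A` separates two vertices or ends: one lies in `A`, the other in the complement. -/
def Separates {G : SimpleGraph V} (A : Set V) (u v : V ⊕ EdgeEnd G) : Prop :=
  (LiesIn A u ∧ LiesIn Aᶜ v) ∨ (LiesIn Aᶜ u ∧ LiesIn A v)

/-- The cut `A` is thin with respect to `u, v`. -/
def IsThinFor {G : SimpleGraph V} (c : G.edgeSet → ℕ+) (A : Set V)
    (u v : V ⊕ EdgeEnd G) : Prop :=
  IsCut G A ∧ Separates A u v ∧
    ∀ B : Set V, IsCut G B → Separates B u v → capacity c A ≤ capacity c B

/-- The thin cuts of capacity `n`. -/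
def thinCuts {G : SimpleGraph V} (c : G.edgeSet → ℕ+) (n : ℕ) : Set (Set V) :=
  {A | (∃ u v : V ⊕ EdgeEnd G, IsThinFor c A u v) ∧ capacity c A = n}

/-- Two sets are nested if one of their four corners is empty. -/
def Nested (A B : Set V) : Prop :=
  A ∩ B = ∅ ∨ Aᶜ ∩ B = ∅ ∨ A ∩ Bᶜ = ∅ ∨ Aᶜ ∩ Bᶜ = ∅

/-- The number of members of `𝒞` that are not nested with `A`. -/
noncomputable def crossingNumber (A : Set V) (𝒞 : Set (Set V)) : ℕ∞ :=
  {C ∈ 𝒞 | ¬ Nested A C}.encard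

/-- The members of `𝒟` that, for some `u, v`, are thin with respect to `u, v` and cross the fewest
members of `𝒟` among the members of `𝒟` that are thin with respect to `u, v`. -/
def optimallyNested {G : SimpleGraph V} (c : G.edgeSet → ℕ+) (𝒟 : Set (Set V)) : Set (Set V) :=
  {D ∈ 𝒟 | ∃ u v : V ⊕ EdgeEnd G, IsThinFor c D u v ∧
    ∀ D' ∈ 𝒟, IsThinFor c D' u v → crossingNumber D 𝒟 ≤ crossingNumber D' 𝒟}

/-- The sets `𝓔 n`: `𝓔 1` is the set of thin cuts of capacity `1`, and `𝓔 n` is obtained from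
`𝓔 (n - 1)` by adding the optimally nested members of the set of those thin cuts of capacity `n`
that cross no member of `𝓔 (n - 1)`. -/
def stage {G : SimpleGraph V} (c : G.edgeSet → ℕ+) : ℕ → Set (Set V)
  | 0 => ∅
  | 1 => thinCuts c 1
  | n + 2 => stage c (n + 1) ∪
      optimallyNested c {A ∈ thinCuts c (n + 2) | crossingNumber A (stage c (n + 1)) = 0}

/-- The set `𝓔`, the union of all the `𝓔 n`. -/
def allStages {G : SimpleGraph V} (c : G.edgeSet → ℕ+) : Set (Set V) :=
  ⋃ n, stage c n

/-- The ring of subsets of `V` generated by `𝒮`: addition is symmetric difference, multiplication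
is intersection, the unit is the whole of `V`. -/
def generatedRing (𝒮 : Set (Set V)) : Subring (AsBoolRing (Set V)) :=
  Subring.closure (toBoolRing '' 𝒮)

/-- The initial vertex of the directed edge `A`. It is a `{0, 1}`-valued map on `ℰ`, written as the
set of those `B ∈ ℰ` at which it takes the value `1`. The terminal vertex of `A` is the initial
vertex of `Aᶜ`. -/
def initialVertex (ℰ : Set (Set V)) (A : Set V) : Set (Set V) :=
  {B ∈ ℰ | A ⊆ B ∨ Aᶜ ⊂ B}

/-- The vertices of the structure tree of `ℰ`: the initial vertices of the members of `ℰ`. If `ℰ`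
is empty, there is a single vertex, namely the empty map. -/
def StructureTreeVertex (ℰ : Set (Set V)) : Type _ :=
  {α : Set (Set V) // (∃ A ∈ ℰ, α = initialVertex ℰ A) ∨ (ℰ = ∅ ∧ α = ∅)}

/-- The structure tree of `ℰ`: each `A ∈ ℰ` joins its initial vertex to its terminal vertex. -/
def structureTree (ℰ : Set (Set V)) : SimpleGraph (StructureTreeVertex ℰ) :=
  SimpleGraph.fromRel fun x y =>
    ∃ A ∈ ℰ, x.1 = initialVertex ℰ A ∧ y.1 = initialVertex ℰ Aᶜ

/-- `ℰ` is the directed edge set of a tree: the structure tree of `ℰ` is a tree, complementation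
maps `ℰ` to itself, and sending `A ∈ ℰ` to the ordered pair formed by its initial vertex and its
terminal vertex is a bijection from `ℰ` onto the directed edges of this tree (so that the reverse
of the directed edge `A` is `Aᶜ`). -/
def IsDirectedEdgeSetOfTree (ℰ : Set (Set V)) : Prop :=
  (structureTree ℰ).IsTree ∧
  (∀ A ∈ ℰ, Aᶜ ∈ ℰ) ∧
  (∀ A ∈ ℰ, ∃ x y, (structureTree ℰ).Adj x y ∧
    x.1 = initialVertex ℰ A ∧ y.1 = initialVertex ℰ Aᶜ) ∧
  ∀ x y, (structureTree ℰ).Adj x y →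
    ∃! A, A ∈ ℰ ∧ x.1 = initialVertex ℰ A ∧ y.1 = initialVertex ℰ Aᶜ

end CutTree

/-! Capacity is submodular, and a thin cut is a bond: both of its sides are connected. Only finitely
many bonds of capacity at most `n` separate two given vertices (`finite_bonds_separating`), so a cut
crosses only finitely many of them (`IsCut.finite_crossing_bonds`) and crossing numbers can drive
minimality arguments and inductions.

Uncrossing does the rest. Two opposite corners of crossing cuts together cross strictly less than
the two cuts do (`crossingNumber_corners_lt`), so optimally nested cuts of the same capacity cannot
cross (`nested_of_mem_optimallyNested`). If a thin cut crosses a member of a stage below its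
capacity, some corner is still thin for the same pair and crosses fewer members
(`exists_isThinFor_nested`); hence every separable pair has a thin cut in some stage.

Each stage is thus nested, closed under complementation and has finite intervals, which makes it the
edge set of a tree (`isDirectedEdgeSetOfTree`). For generation, uncrossing reduces to a cut `A`
nested with the whole stage. By compactness of the space of vertices and ends
(`IsCut.finitelyCovered`), if `A` is not in the ring then some point of `A` avoids every member of
the stage inside `A`, and likewise for `Aᶜ`. A member of the stage separating these two points
cannot be nested with `A`. -/

namespace CutTree

variable {V : Type*} {G : SimpleGraph V} {c : G.edgeSet → ℕ+} {A B C : Set V}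

/-! ### Boolean operations on cuts and their boundaries. -/

section Coboundary

theorem mk_mem_coboundary {x y : V} (h : s(x, y) ∈ G.edgeSet) :
    (⟨s(x, y), h⟩ : G.edgeSet) ∈ coboundary G A ↔ (x ∈ A ∧ y ∉ A) ∨ (x ∉ A ∧ y ∈ A) := by
  simp only [coboundary, Set.mem_ofPred_eq, Sym2.mem_iff, exists_eq_or_imp, exists_eq_left]
  tauto

theorem coboundary_compl (A : Set V) : coboundary G Aᶜ = coboundary G A := by
  ext ⟨e, he⟩
  induction e with
  | _ x y =>
    simp only [mk_mem_coboundary, Set.mem_compl_iff]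
    tauto

theorem coboundary_inter_subset (A B : Set V) :
    coboundary G (A ∩ B) ⊆ coboundary G A ∪ coboundary G B := by
  rintro ⟨e, he⟩ h
  induction e with
  | _ x y =>
    simp only [mk_mem_coboundary, Set.mem_union, Set.mem_inter_iff] at h ⊢
    tauto

theorem IsCut.compl (hA : IsCut G A) : IsCut G Aᶜ := by
  rwa [IsCut, coboundary_compl]

theorem IsCut.inter (hA : IsCut G A) (hB : IsCut G B) : IsCut G (A ∩ B) :=
  (hA.union hB).subset (coboundary_inter_subset A B)

theorem IsCut.union (hA : IsCut G A) (hB : IsCut G B) : IsCut G (A ∪ B) := by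
  have := (hA.compl.inter hB.compl).compl
  rwa [Set.compl_inter, compl_compl, compl_compl] at this

theorem IsCut.diff (hA : IsCut G A) (hB : IsCut G B) : IsCut G (A \ B) :=
  hA.inter hB.compl

theorem isCut_empty : IsCut G ∅ := by
  simp [IsCut, coboundary]

theorem IsCut.sUnion {𝓕 : Set (Set V)} (hf : 𝓕.Finite) (h : ∀ A ∈ 𝓕, IsCut G A) :
    IsCut G (⋃₀ 𝓕) := by
  induction 𝓕, hf using Set.Finite.induction_on with
  | empty => simpa using isCut_empty
  | insert _ _ ih =>
    rw [Set.sUnion_insert]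
    exact (h _ (Set.mem_insert _ _)).union (ih fun A hA => h A (Set.mem_insert_of_mem _ hA))

theorem exists_adj_of_ne_univ (hG : G.Connected) (hA : A.Nonempty) (hA' : A ≠ Set.univ) :
    ∃ x ∈ A, ∃ y ∉ A, G.Adj x y := by
  obtain ⟨x, hx⟩ := hA
  obtain ⟨y, hy⟩ := (Set.ne_univ_iff_exists_notMem A).1 hA'
  obtain ⟨p⟩ := hG.preconnected x y
  obtain ⟨d, -, h1, h2⟩ := p.exists_boundary_dart A hx hy
  exact ⟨d.fst, h1, d.snd, h2, d.adj⟩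

theorem coboundary_nonempty (hG : G.Connected) (hA : A.Nonempty) (hA' : A ≠ Set.univ) :
    (coboundary G A).Nonempty := by
  obtain ⟨x, hx, y, hy, h⟩ := exists_adj_of_ne_univ hG hA hA'
  exact ⟨⟨s(x, y), h⟩, (mk_mem_coboundary h).2 (Or.inl ⟨hx, hy⟩)⟩

/-- The vertices incident with an edge of the coboundary of `A`. -/
def boundaryVertices (G : SimpleGraph V) (A : Set V) : Set V :=
  {x | ∃ y, G.Adj x y ∧ ¬(x ∈ A ↔ y ∈ A)}

theorem IsCut.finite_boundaryVertices (hA : IsCut G A) : (boundaryVertices G A).Finite := by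
  have : (⋃ e ∈ coboundary G A, {x | x ∈ e.1}).Finite := by
    refine Set.Finite.biUnion hA ?_
    rintro ⟨e, he⟩ -
    induction e with
    | _ x y =>
      refine (Set.toFinite {x, y}).subset fun z hz => ?_
      simpa using hz
  refine this.subset ?_
  rintro x ⟨y, hxy, h⟩
  simp only [Set.mem_iUnion]
  exact ⟨⟨s(x, y), hxy⟩, (mk_mem_coboundary hxy).2 (by tauto), Sym2.mem_mk_left x y⟩

end Coboundary

/-! ### Capacity and its submodularity. -/

section Capacity

theorem capacity_compl (A : Set V) : capacity c Aᶜ = capacity c A := by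
  rw [capacity, coboundary_compl, capacity]

theorem capacity_eq_sum (c : G.edgeSet → ℕ+) {F : Finset G.edgeSet} (h : coboundary G A ⊆ F) :
    capacity c A = ∑ e ∈ F, (coboundary G A).indicator (fun e => (c e : ℕ)) e := by
  rw [capacity, finsum_mem_def]
  exact finsum_eq_sum_of_support_subset _ (Set.support_indicator_subset.trans h)

theorem capacity_inter_add_capacity_union_le (c : G.edgeSet → ℕ+) (hA : IsCut G A)
    (hB : IsCut G B) :
    capacity c (A ∩ B) + capacity c (A ∪ B) ≤ capacity c A + capacity c B := by
  classical
  obtain ⟨F, hF⟩ := Set.Finite.exists_finset_coe (Set.Finite.union hA hB)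
  replace hF := hF.superset
  rw [capacity_eq_sum c (Set.subset_union_left.trans hF),
    capacity_eq_sum c (Set.subset_union_right.trans hF),
    capacity_eq_sum c ((coboundary_inter_subset A B).trans hF),
    capacity_eq_sum c (A := A ∪ B) (F := F),
    ← Finset.sum_add_distrib, ← Finset.sum_add_distrib]
  · refine Finset.sum_le_sum ?_
    rintro ⟨e, he⟩ -
    induction e with
    | _ x y =>
      simp only [Set.indicator_apply, mk_mem_coboundary, Set.mem_inter_iff, Set.mem_union]
      by_cases h1 : x ∈ A <;> by_cases h2 : y ∈ A <;> by_cases h3 : x ∈ B <;>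
        by_cases h4 : y ∈ B <;> simp [h1, h2, h3, h4]
  · refine Set.Subset.trans ?_ hF
    rw [← coboundary_compl, ← coboundary_compl A, ← coboundary_compl B, Set.compl_union]
    exact coboundary_inter_subset _ _

theorem capacity_lt_capacity (c : G.edgeSet → ℕ+) (hB : IsCut G B)
    (h : coboundary G A ⊂ coboundary G B) : capacity c A < capacity c B := by
  obtain ⟨F, hF⟩ := Set.Finite.exists_finset_coe hB
  rw [capacity_eq_sum c hF.superset, capacity_eq_sum c (h.1.trans hF.superset)]
  obtain ⟨e, heB, heA⟩ := Set.exists_of_ssubset h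
  refine Finset.sum_lt_sum (fun i _ => ?_) ⟨e, by rwa [← hF] at heB, ?_⟩
  · exact Set.indicator_le_indicator_of_subset h.1 (fun _ => Nat.zero_le _) i
  · simp [heA, heB]

theorem ncard_coboundary_le_capacity (c : G.edgeSet → ℕ+) (hA : IsCut G A) :
    (coboundary G A).ncard ≤ capacity c A := by
  obtain ⟨F, hF⟩ := Set.Finite.exists_finset_coe hA
  rw [capacity_eq_sum c hF.superset, ← hF, Set.ncard_coe_finset, Finset.card_eq_sum_ones]
  refine Finset.sum_le_sum fun e he => ?_
  rw [Set.indicator_of_mem (Finset.mem_coe.2 he)]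
  exact (c e).pos

theorem capacity_pos (c : G.edgeSet → ℕ+) (hG : G.Connected) (hA : IsCut G A) (h : A.Nonempty)
    (h' : A ≠ Set.univ) : 0 < capacity c A :=
  lt_of_lt_of_le ((Set.ncard_pos hA).2 (coboundary_nonempty hG h h'))
    (ncard_coboundary_le_capacity c hA)

end Capacity

/-! ### Vertices and ends as points; separation and thinness. -/

section Points

/-- One representative suffices, because a cut cannot separate equivalent rays. -/
theorem liesIn_inr_mk (hA : IsCut G A) (R : Ray G) :
    LiesIn A (Sum.inr (Quotient.mk (raySetoid G) R)) ↔ ∀ᶠ n in atTop, R.toFun n ∈ A := by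
  refine ⟨fun h => h R rfl, fun h S hS => ?_⟩
  refine (S.eventually_mem_or hA).resolve_right fun h' => ?_
  have hRS : ∀ A, IsCut G A → ¬ SeparatesRays A S R := Quotient.exact hS
  refine hRS A hA ?_
  filter_upwards [h, h'] with n h1 h2
  exact Or.inr ⟨h2, h1⟩

theorem liesIn_compl (hA : IsCut G A) (p : V ⊕ EdgeEnd G) : LiesIn Aᶜ p ↔ ¬ LiesIn A p := by
  rcases p with v | ω
  · rfl
  · induction ω using Quotient.inductionOn with
    | h R =>
      rw [liesIn_inr_mk hA, liesIn_inr_mk hA.compl]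
      constructor
      · intro h h'
        obtain ⟨n, h1, h2⟩ := (h.and h').exists
        exact h1 h2
      · intro h
        exact (R.eventually_mem_or hA).resolve_left h

theorem liesIn_inter (A B : Set V) (p : V ⊕ EdgeEnd G) :
    LiesIn (A ∩ B) p ↔ LiesIn A p ∧ LiesIn B p := by
  rcases p with v | ω
  · rfl
  · simp only [LiesIn, Set.mem_inter_iff, eventually_and]
    exact ⟨fun h => ⟨fun R hR => (h R hR).1, fun R hR => (h R hR).2⟩,
      fun h R hR => ⟨h.1 R hR, h.2 R hR⟩⟩

theorem liesIn_union (hA : IsCut G A) (hB : IsCut G B) (p : V ⊕ EdgeEnd G) :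
    LiesIn (A ∪ B) p ↔ LiesIn A p ∨ LiesIn B p := by
  rw [← compl_compl (A ∪ B), Set.compl_union, liesIn_compl (hA.compl.inter hB.compl),
    liesIn_inter, liesIn_compl hA, liesIn_compl hB]
  tauto

theorem liesIn_mono (h : A ⊆ B) {p : V ⊕ EdgeEnd G} (hp : LiesIn A p) : LiesIn B p := by
  rw [← Set.inter_eq_left.2 h, liesIn_inter] at hp
  exact hp.2

theorem separates_iff (hA : IsCut G A) {u v : V ⊕ EdgeEnd G} :
    Separates A u v ↔ ¬(LiesIn A u ↔ LiesIn A v) := by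
  rw [Separates, liesIn_compl hA, liesIn_compl hA]
  tauto

theorem separates_compl {u v : V ⊕ EdgeEnd G} : Separates Aᶜ u v ↔ Separates A u v := by
  rw [Separates, Separates, compl_compl]
  tauto

theorem not_liesIn_empty (p : V ⊕ EdgeEnd G) : ¬ LiesIn ∅ p := by
  rw [← liesIn_compl isCut_empty, Set.compl_empty]
  rcases p with v | ω
  · trivial
  · intro R _
    simp

theorem Separates.nonempty (hA : IsCut G A) {u v : V ⊕ EdgeEnd G} (h : Separates A u v) :
    A.Nonempty := by
  by_contra h'
  rw [Set.not_nonempty_iff_eq_empty] at h'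
  subst h'
  rw [separates_iff hA] at h
  simp [not_liesIn_empty] at h

theorem IsThinFor.compl {u v : V ⊕ EdgeEnd G} (h : IsThinFor c A u v) : IsThinFor c Aᶜ u v :=
  ⟨h.1.compl, separates_compl.2 h.2.1, by simpa only [capacity_compl] using h.2.2⟩

theorem IsThinFor.nonempty {u v : V ⊕ EdgeEnd G} (h : IsThinFor c A u v) : A.Nonempty :=
  h.2.1.nonempty h.1

theorem IsThinFor.ne_univ {u v : V ⊕ EdgeEnd G} (h : IsThinFor c A u v) : A ≠ Set.univ := by
  rintro rfl
  simpa using h.compl.nonempty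

theorem IsThinFor.capacity_pos (hG : G.Connected) {u v : V ⊕ EdgeEnd G}
    (h : IsThinFor c A u v) : 0 < capacity c A :=
  CutTree.capacity_pos c hG h.1 h.nonempty h.ne_univ

theorem exists_isThinFor {u v : V ⊕ EdgeEnd G} (hB : IsCut G B) (h : Separates B u v) :
    ∃ A, IsThinFor c A u v := by
  obtain ⟨A, ⟨hA, hA'⟩, hmin⟩ := (measure (capacity c)).wf.has_min
    {A : Set V | IsCut G A ∧ Separates A u v} ⟨B, hB, h⟩
  exact ⟨A, hA, hA', fun C hC hC' => not_lt.1 (hmin C ⟨hC, hC'⟩)⟩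

end Points

/-! ### Thin cuts are connected. -/

section ConnectedSet

/-- A set of vertices is connected if it has no proper nonempty subset without edges to the rest. -/
def ConnectedSet (G : SimpleGraph V) (A : Set V) : Prop :=
  ∀ B ⊆ A, B.Nonempty → (A \ B).Nonempty → ∃ x ∈ B, ∃ y ∈ A \ B, G.Adj x y

theorem ConnectedSet.subset_or_subset_compl (hC : ConnectedSet G C)
    (h : ∀ x ∈ C, ∀ y ∈ C, G.Adj x y → x ∈ A → y ∈ A) : C ⊆ A ∨ C ⊆ Aᶜ := by
  by_contra! hne
  obtain ⟨h1, h2⟩ := hne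
  obtain ⟨y, hyC, hyA⟩ := Set.not_subset.1 h1
  obtain ⟨x, hxC, hxA⟩ := Set.not_subset.1 h2
  obtain ⟨x, hx, y, hy, hxy⟩ := hC (C ∩ A) Set.inter_subset_left ⟨x, hxC, not_not.1 hxA⟩
    ⟨y, hyC, fun h => hyA h.2⟩
  exact hy.2 ⟨hy.1, h x hx.1 y hy.1 hxy hx.2⟩

theorem ConnectedSet.subset_or_subset_compl_of_disjoint (hC : ConnectedSet G C)
    (h : ∀ x ∈ boundaryVertices G A, x ∉ C) : C ⊆ A ∨ C ⊆ Aᶜ := by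
  refine hC.subset_or_subset_compl fun x hx y _ hxy hxA => ?_
  by_contra hyA
  exact h x ⟨y, hxy, by tauto⟩ hx

/-- A cut that is not connected is the union of two cuts of smaller capacity. -/
theorem IsCut.exists_split (c : G.edgeSet → ℕ+) (hG : G.Connected) (hA : IsCut G A)
    (h : ¬ ConnectedSet G A) :
    ∃ B C, A = B ∪ C ∧ IsCut G B ∧ IsCut G C ∧
      capacity c B < capacity c A ∧ capacity c C < capacity c A := by
  unfold ConnectedSet at h
  push Not at h
  obtain ⟨B, hBA, hB, hAB, hadj⟩ := h
  have key : ∀ B C : Set V, B ∪ C = A → Disjoint B C → C.Nonempty → B.Nonempty →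
      (∀ x ∈ B, ∀ y ∈ C, ¬ G.Adj x y) → coboundary G B ⊂ coboundary G A := by
    rintro B C rfl hdisj hC ⟨b, hb⟩ hadj
    constructor
    · rintro ⟨e, he⟩ hmem
      induction e with
      | _ x y =>
        rw [mk_mem_coboundary] at hmem ⊢
        have h1 := hadj x
        have h2 := hadj y
        have h3 : G.Adj x y := he
        have h4 := h3.symm
        simp only [Set.mem_union]
        tauto
    · intro hsub
      have hCne : C ≠ Set.univ := by
        rintro rfl
        exact hdisj.notMem_of_mem_left hb trivial
      obtain ⟨x, hx, y, hy, hxy⟩ := exists_adj_of_ne_univ hG hC hCne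
      have hyB : y ∉ B := fun h => hadj y h x hx hxy.symm
      have hxB : x ∉ B := hdisj.notMem_of_mem_right hx
      have := hsub ((mk_mem_coboundary (A := B ∪ C) hxy).2 (Or.inl ⟨Or.inr hx, by simp [hy, hyB]⟩))
      have := (mk_mem_coboundary hxy).1 this
      tauto
  have hu : B ∪ A \ B = A := Set.union_sdiff_cancel hBA
  have h1 := key B (A \ B) hu Set.disjoint_sdiff_right hAB hB hadj
  have h2 := key (A \ B) B (by rw [Set.union_comm, hu]) Set.disjoint_sdiff_left hB hAB
    fun x hx y hy hxy => hadj y hy x hx hxy.symm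
  exact ⟨B, A \ B, hu.symm, hA.subset h1.1, hA.subset h2.1, capacity_lt_capacity c hA h1,
    capacity_lt_capacity c hA h2⟩

/-- If `A` split into two cuts of smaller capacity, one of them would still separate `u` from `v`.
-/
theorem IsThinFor.connectedSet (hG : G.Connected) {u v : V ⊕ EdgeEnd G}
    (h : IsThinFor c A u v) : ConnectedSet G A := by
  by_contra hA
  obtain ⟨B, C, rfl, hB, hC, hBc, hCc⟩ := h.1.exists_split c hG hA
  have h1 := h.2.1
  have h2 := fun hs => not_lt.2 (h.2.2 B hB hs) hBc
  have h3 := fun hs => not_lt.2 (h.2.2 C hC hs) hCc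
  rw [separates_iff h.1, liesIn_union hB hC, liesIn_union hB hC] at h1
  rw [separates_iff hB] at h2
  rw [separates_iff hC] at h3
  tauto

end ConnectedSet

/-! ### Finiteness of bonds of bounded capacity. -/

section Bonds

/-- A bond: a cut that is connected and has connected complement. -/
structure IsBond (G : SimpleGraph V) (A : Set V) : Prop where
  isCut : IsCut G A
  connectedSet : ConnectedSet G A
  connectedSet_compl : ConnectedSet G Aᶜ

theorem IsBond.compl (h : IsBond G A) : IsBond G Aᶜ :=
  ⟨h.isCut.compl, h.connectedSet_compl, by simpa using h.connectedSet⟩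

theorem IsThinFor.isBond (hG : G.Connected) {u v : V ⊕ EdgeEnd G}
    (h : IsThinFor c A u v) : IsBond G A :=
  ⟨h.1, h.connectedSet hG, h.compl.connectedSet hG⟩

theorem ConnectedSet.reachable_deleteEdges {F : Set (Sym2 V)} (hA : ConnectedSet G A)
    (hF : F ⊆ Subtype.val '' coboundary G A) {x y : V} (hx : x ∈ A) (hy : y ∈ A) :
    (G.deleteEdges F).Reachable x y := by
  have := hA.subset_or_subset_compl (A := {z | (G.deleteEdges F).Reachable x z}) ?_
  · rcases this with h | h
    · exact h hy
    · exact absurd (SimpleGraph.Reachable.refl x) (h hx)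
  · intro a ha b hb hab hxa
    refine SimpleGraph.Reachable.trans hxa (SimpleGraph.Adj.reachable ?_)
    rw [SimpleGraph.deleteEdges_adj]
    refine ⟨hab, fun h => ?_⟩
    obtain ⟨⟨e, he⟩, h1, h2⟩ := hF h
    dsimp only at h2
    subst h2
    rw [mk_mem_coboundary] at h1
    tauto

/-- `F` records edges already known to lie in the coboundary, and `k` bounds how many more can be
found before exceeding `n`. If a path from `x` to `y` survives the deletion of `F`, the coboundary
contains one of its finitely many edges, which is added to `F`. Otherwise `A` must be the component
of `x` in `G` minus `F`. -/
theorem finite_bonds_containing (c : G.edgeSet → ℕ+) (n : ℕ) (x y : V) (k : ℕ) :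
    ∀ F : Finset (Sym2 V), n < F.card + k →
      {A | IsBond G A ∧ capacity c A ≤ n ∧ x ∈ A ∧ y ∉ A ∧
        (F : Set (Sym2 V)) ⊆ Subtype.val '' coboundary G A}.Finite := by
  classical
  induction k with
  | zero =>
    intro F hF
    convert Set.finite_empty
    rw [Set.eq_empty_iff_forall_notMem]
    rintro A ⟨hA, hn, -, -, hFA⟩
    have h1 := Set.ncard_le_ncard hFA (hA.isCut.image _)
    rw [Set.ncard_coe_finset, Set.ncard_image_of_injective _ Subtype.val_injective] at h1
    have := ncard_coboundary_le_capacity c hA.isCut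
    omega
  | succ k ih =>
    intro F hF
    by_cases hxy : (G.deleteEdges F).Reachable x y
    · obtain ⟨p⟩ := hxy
      have hfin : (⋃ e ∈ {e | e ∈ p.edges},
          {A | IsBond G A ∧ capacity c A ≤ n ∧ x ∈ A ∧ y ∉ A ∧ e ∉ F ∧
            ((insert e F : Finset (Sym2 V)) : Set (Sym2 V)) ⊆
              Subtype.val '' coboundary G A}).Finite := by
        refine Set.Finite.biUnion (List.finite_toSet _) fun e _ => ?_
        by_cases he : e ∈ F
        · simp [he]
        · refine (ih (insert e F) ?_).subset ?_
          · rw [Finset.card_insert_of_notMem he]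
            omega
          · rintro A ⟨h1, h2, h3, h4, -, h5⟩
            exact ⟨h1, h2, h3, h4, h5⟩
      refine hfin.subset ?_
      rintro A ⟨hA, hn, hx, hy, hFA⟩
      obtain ⟨d, hd, h1, h2⟩ := p.exists_boundary_dart A hx hy
      have hadj := d.adj
      rw [SimpleGraph.deleteEdges_adj] at hadj
      simp only [Set.mem_iUnion]
      refine ⟨s(d.fst, d.snd), ?_, hA, hn, hx, hy, fun h => hadj.2 h, ?_⟩
      · exact List.mem_map.2 ⟨d, hd, rfl⟩
      · rw [Finset.coe_insert, Set.insert_subset_iff]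
        exact ⟨⟨⟨_, hadj.1⟩, (mk_mem_coboundary hadj.1).2 (Or.inl ⟨h1, h2⟩), rfl⟩, hFA⟩
    · refine (Set.finite_singleton {z | (G.deleteEdges F).Reachable x z}).subset ?_
      rintro A ⟨hA, hn, hx, hy, hFA⟩
      rw [Set.mem_singleton_iff]
      ext z
      refine ⟨fun hz => hA.connectedSet.reachable_deleteEdges hFA hx hz, fun hz => ?_⟩
      by_contra hzA
      refine hxy (SimpleGraph.Reachable.trans hz ?_)
      exact hA.connectedSet_compl.reachable_deleteEdges (by rwa [coboundary_compl]) hzA hy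

theorem finite_bonds_separating (c : G.edgeSet → ℕ+) (n : ℕ) (x y : V) :
    {A | IsBond G A ∧ capacity c A ≤ n ∧ x ∈ A ∧ y ∉ A}.Finite := by
  refine (finite_bonds_containing c n x y (n + 1) ∅ (by simp)).subset ?_
  rintro A ⟨h1, h2, h3, h4⟩
  exact ⟨h1, h2, h3, h4, by simp⟩

/-- Both sides of a bond crossing `A` are connected and meet `A` and `Aᶜ`, so each contains one of
the finitely many boundary vertices of `A`. The bond therefore separates two of these. -/
theorem IsCut.finite_crossing_bonds (c : G.edgeSet → ℕ+) (n : ℕ) (hA : IsCut G A) :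
    {B | IsBond G B ∧ capacity c B ≤ n ∧ ¬ Nested A B}.Finite := by
  have hfin : (⋃ x ∈ boundaryVertices G A, ⋃ y ∈ boundaryVertices G A,
      {B | IsBond G B ∧ capacity c B ≤ n ∧ x ∈ B ∧ y ∉ B}).Finite :=
    hA.finite_boundaryVertices.biUnion fun x _ => hA.finite_boundaryVertices.biUnion fun y _ =>
      finite_bonds_separating c n x y
  refine hfin.subset ?_
  rintro B ⟨hB, hn, hAB⟩
  have key : ∀ B, IsBond G B → ¬ Nested A B → ∃ x ∈ boundaryVertices G A, x ∈ B := by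
    intro B hB hAB
    by_contra! h
    rcases hB.connectedSet.subset_or_subset_compl_of_disjoint h with h | h
    · exact hAB (Or.inr (Or.inl ((Set.disjoint_compl_left_iff_subset.2 h).inter_eq)))
    · exact hAB (Or.inl ((Set.disjoint_right.2 h).inter_eq))
  obtain ⟨x, hx, hxB⟩ := key B hB hAB
  obtain ⟨y, hy, hyB⟩ := key Bᶜ hB.compl (by
    unfold Nested at *
    rw [compl_compl]
    tauto)
  simp only [Set.mem_iUnion]
  exact ⟨x, hx, y, hy, hB, hn, hxB, hyB⟩

end Bonds

end CutTree

namespace CutTree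

/-! ### Trees from nested families of sets. -/

section StructureTree

variable {V : Type*} {ℰ : Set (Set V)} {A B C : Set V}

theorem nested_iff : Nested A B ↔ A ⊆ Bᶜ ∨ B ⊆ A ∨ A ⊆ B ∨ Aᶜ ⊆ B := by
  simp only [Nested, ← Set.disjoint_iff_inter_eq_empty, Set.disjoint_compl_left_iff_subset,
    Set.disjoint_compl_right_iff_subset, Set.subset_compl_iff_disjoint_right]

theorem mem_initialVertex_self (hA : A ∈ ℰ) : A ∈ initialVertex ℰ A :=
  ⟨hA, Or.inl subset_rfl⟩

theorem notMem_initialVertex_compl (h : A.Nonempty) : Aᶜ ∉ initialVertex ℰ A := by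
  rintro ⟨-, h1 | h1⟩
  · obtain ⟨x, hx⟩ := h
    exact h1 hx hx
  · exact h1.ne rfl

theorem subset_of_initialVertex_eq (hB : B ∈ ℰ) (hAc : Aᶜ ∈ ℰ)
    (h : initialVertex ℰ A = initialVertex ℰ B)
    (h' : initialVertex ℰ Aᶜ = initialVertex ℰ Bᶜ) : A ⊆ B := by
  have h1 : B ∈ initialVertex ℰ A := h ▸ mem_initialVertex_self hB
  have h2 : Aᶜ ∈ initialVertex ℰ Bᶜ := h' ▸ mem_initialVertex_self hAc
  rcases h1.2 with h1 | h1
  · exact h1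
  rcases h2.2 with h2 | h2
  · exact Set.compl_subset_compl.1 h2
  · rw [compl_compl] at h2
    exact absurd h2 (asymm h1)

theorem initialVertex_compl_subset (hA : A.Nonempty) (hC : C ∈ ℰ)
    (hnest : ∀ A ∈ ℰ, ∀ B ∈ ℰ, Nested A B) (hAC : A ⊂ C)
    (h : ∀ D ∈ ℰ, A ⊂ D → D ⊆ C → D = C) :
    initialVertex ℰ Aᶜ ⊆ initialVertex ℰ C := by
  rintro B ⟨hB, hAB⟩
  refine ⟨hB, ?_⟩
  rw [compl_compl] at hAB
  rcases hAB with hAB | hAB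
  · exact Or.inr (lt_of_lt_of_le (compl_lt_compl_iff_lt.2 hAC) hAB)
  · rcases nested_iff.1 (hnest B hB C hC) with h1 | h1 | h1 | h1
    · obtain ⟨x, hx⟩ := hA
      exact absurd (hAC.subset hx) (h1 (hAB.subset hx))
    · exact Or.inl h1
    · exact Or.inl (h B hB hAB h1).superset
    · rcases (Set.compl_subset_comm.1 h1).eq_or_ssubset with h2 | h2
      · obtain ⟨x, hx⟩ := hA
        have := hAB.subset hx
        rw [← h2] at this
        exact absurd (hAC.subset hx) this
      · exact Or.inr h2

/-- Nothing in `ℰ` lies strictly between `A` and `C`, so the two edges are consecutive: `A` ends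
where `C` starts. The second inclusion is the first one applied to `Cᶜ ⊂ Aᶜ`. -/
theorem initialVertex_compl_eq (hA : A.Nonempty) (hCu : Cᶜ.Nonempty) (hAℰ : Aᶜ ∈ ℰ) (hC : C ∈ ℰ)
    (hcompl : ∀ A ∈ ℰ, Aᶜ ∈ ℰ)
    (hnest : ∀ A ∈ ℰ, ∀ B ∈ ℰ, Nested A B) (hAC : A ⊂ C)
    (h : ∀ D ∈ ℰ, A ⊂ D → D ⊆ C → D = C) :
    initialVertex ℰ Aᶜ = initialVertex ℰ C := by
  refine (initialVertex_compl_subset hA hC hnest hAC h).antisymm ?_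
  have := initialVertex_compl_subset (C := Aᶜ) hCu hAℰ hnest (compl_lt_compl_iff_lt.2 hAC) ?_
  · rwa [compl_compl] at this
  · intro D hD h1 h2
    by_contra hne
    have h3 : A ⊆ Dᶜ := Set.subset_compl_comm.1 h2
    have h4 : Dᶜ ⊂ C := by
      have := compl_lt_compl_iff_lt.2 h1
      rwa [compl_compl] at this
    refine h4.ne (h _ (hcompl D hD) (h3.ssubset_of_ne fun h5 => hne ?_) h4.subset)
    rw [h5, compl_compl]

/-- The initial vertex of `A ∈ ℰ`, as a vertex of the structure tree. -/
def source (hA : A ∈ ℰ) : StructureTreeVertex ℰ :=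
  ⟨initialVertex ℰ A, Or.inl ⟨A, hA, rfl⟩⟩

theorem structureTree_adj_iff (hne : ∀ A ∈ ℰ, A.Nonempty) (hcompl : ∀ A ∈ ℰ, Aᶜ ∈ ℰ)
    {x y : StructureTreeVertex ℰ} :
    (structureTree ℰ).Adj x y ↔
      ∃ A ∈ ℰ, x.1 = initialVertex ℰ A ∧ y.1 = initialVertex ℰ Aᶜ := by
  rw [structureTree, SimpleGraph.fromRel_adj]
  constructor
  · rintro ⟨-, h | ⟨A, hA, h1, h2⟩⟩
    · exact h
    · exact ⟨Aᶜ, hcompl A hA, h2, by rwa [compl_compl]⟩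
  · rintro ⟨A, hA, h1, h2⟩
    refine ⟨?_, Or.inl ⟨A, hA, h1, h2⟩⟩
    rintro rfl
    refine notMem_initialVertex_compl (ℰ := ℰ) (hne _ hA) ?_
    rw [← h1, h2]
    exact mem_initialVertex_self (hcompl A hA)

theorem structureTree_adj_source (hne : ∀ A ∈ ℰ, A.Nonempty) (hcompl : ∀ A ∈ ℰ, Aᶜ ∈ ℰ)
    (hA : A ∈ ℰ) : (structureTree ℰ).Adj (source hA) (source (hcompl A hA)) :=
  (structureTree_adj_iff hne hcompl).2 ⟨A, hA, rfl, rfl⟩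

/-- The finite interval from `A` to `C` is climbed one minimal step at a time, each step crossing
one edge of the tree. -/
theorem reachable_of_subset (hne : ∀ A ∈ ℰ, A.Nonempty) (hcompl : ∀ A ∈ ℰ, Aᶜ ∈ ℰ)
    (hnest : ∀ A ∈ ℰ, ∀ B ∈ ℰ, Nested A B)
    (hfin : ∀ A ∈ ℰ, ∀ B ∈ ℰ, {C ∈ ℰ | A ⊆ C ∧ C ⊆ B}.Finite) (hA : A ∈ ℰ) (hC : C ∈ ℰ)
    (hAC : A ⊆ C) : (structureTree ℰ).Reachable (source hA) (source hC) := by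
  induction hn : {D ∈ ℰ | A ⊆ D ∧ D ⊆ C}.ncard using Nat.strong_induction_on generalizing A with
  | _ n ih =>
    rcases hAC.eq_or_ssubset with rfl | hss
    · rfl
    have hf := hfin A hA C hC
    obtain ⟨D, ⟨⟨hD, hAD, hDC⟩, hne'⟩, hmin⟩ := (hf.sdiff (t := {A})).exists_minimal
      ⟨C, ⟨hC, hAC, subset_rfl⟩, hss.ne'⟩
    have hAD' : A ⊂ D := hAD.ssubset_of_ne (Ne.symm hne')
    have heq : initialVertex ℰ Aᶜ = initialVertex ℰ D := by
      refine initialVertex_compl_eq (hne A hA) (hne _ (hcompl D hD)) (hcompl A hA) hD hcompl hnest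
        hAD' fun B hB h1 h2 => h2.antisymm (hmin ⟨⟨hB, h1.subset, h2.trans hDC⟩, h1.ne'⟩ h2)
    have hsrc : source (hcompl A hA) = source hD := Subtype.ext heq
    refine (structureTree_adj_source hne hcompl hA).reachable.trans ?_
    rw [hsrc]
    refine ih _ ?_ hD hDC rfl
    rw [← hn]
    refine Set.ncard_lt_ncard ⟨fun B hB => ⟨hB.1, hAD.trans hB.2.1, hB.2.2⟩, fun h => ?_⟩ hf
    exact hAD'.2 (h ⟨hA, subset_rfl, hAC⟩).2.1

theorem eq_of_mem_initialVertex (h1 : A ∈ initialVertex ℰ B) (h2 : A ∉ initialVertex ℰ Bᶜ) :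
    B = A := by
  by_contra hne
  refine h2 ⟨h1.1, ?_⟩
  rw [compl_compl]
  rcases h1.2 with h | h
  · exact Or.inr (h.ssubset_of_ne hne)
  · exact Or.inl h.subset

/-- A nested set of nonempty sets, closed under complementation and with finite intervals, is the
directed edge set of a tree. -/
theorem isDirectedEdgeSetOfTree (hne : ∀ A ∈ ℰ, A.Nonempty) (hcompl : ∀ A ∈ ℰ, Aᶜ ∈ ℰ)
    (hnest : ∀ A ∈ ℰ, ∀ B ∈ ℰ, Nested A B)
    (hfin : ∀ A ∈ ℰ, ∀ B ∈ ℰ, {C ∈ ℰ | A ⊆ C ∧ C ⊆ B}.Finite) :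
    IsDirectedEdgeSetOfTree ℰ := by
  have hadj {x y} := structureTree_adj_iff (x := x) (y := y) hne hcompl
  refine ⟨⟨?_, ?_⟩, hcompl, fun A hA => ⟨source hA, source (hcompl A hA),
    structureTree_adj_source hne hcompl hA, rfl, rfl⟩, ?_⟩
  · have hnonempty : Nonempty (StructureTreeVertex ℰ) := by
      rcases ℰ.eq_empty_or_nonempty with rfl | ⟨A, hA⟩
      · exact ⟨⟨∅, Or.inr ⟨rfl, rfl⟩⟩⟩
      · exact ⟨source hA⟩
    refine SimpleGraph.Connected.mk ?_
    rintro ⟨x, hx⟩ ⟨y, hy⟩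
    rcases hx with ⟨A, hA, rfl⟩ | ⟨rfl, rfl⟩
    · rcases hy with ⟨B, hB, rfl⟩ | ⟨rfl, rfl⟩
      · change (structureTree ℰ).Reachable (source hA) (source hB)
        have r {A C} (hA : A ∈ ℰ) (hC : C ∈ ℰ) (h : A ⊆ C) :=
          reachable_of_subset hne hcompl hnest hfin hA hC h
        have hA' := (structureTree_adj_source hne hcompl hA).reachable
        have hB' := (structureTree_adj_source hne hcompl hB).reachable
        rcases nested_iff.1 (hnest A hA B hB) with h | h | h | h
        · exact (r hA _ h).trans hB'.symm
        · exact (r hB _ h).symm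
        · exact r hA _ h
        · exact hA'.trans (r _ hB h)
      · exact absurd hA (Set.notMem_empty A)
    · rcases hy with ⟨B, hB, rfl⟩ | ⟨-, rfl⟩
      · exact absurd hB (Set.notMem_empty B)
      · rfl
  -- Every edge is a bridge: a walk from the initial to the terminal vertex of `A` must switch
  -- coordinate `A` from 1 to 0, and by `eq_of_mem_initialVertex` only the edge `A` does so.
  · rw [SimpleGraph.isAcyclic_iff_forall_adj_isBridge]
    intro x y hxy
    rw [SimpleGraph.isBridge_iff]
    obtain ⟨A, hA, hx, hy⟩ := hadj.1 hxy
    rintro ⟨p⟩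
    obtain ⟨d, -, h1, h2⟩ := p.exists_boundary_dart {z | A ∈ z.1}
      (by simpa [hx] using mem_initialVertex_self hA)
      (by
        have := notMem_initialVertex_compl (ℰ := ℰ) (hne _ (hcompl A hA))
        rw [compl_compl] at this
        simpa [hy] using this)
    have hd := d.adj
    rw [SimpleGraph.deleteEdges_adj] at hd
    obtain ⟨B, hB, hx', hy'⟩ := hadj.1 hd.1
    simp only [Set.mem_ofPred_eq, hx', hy'] at h1 h2
    obtain rfl := eq_of_mem_initialVertex h1 h2
    refine hd.2 ?_
    have hdx : d.fst = x := Subtype.ext (hx'.trans hx.symm)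
    have hdy : d.snd = y := Subtype.ext (hy'.trans hy.symm)
    rw [hdx, hdy, Set.mem_singleton_iff]
  · intro x y hxy
    obtain ⟨A, hA, hx, hy⟩ := hadj.1 hxy
    refine ⟨A, ⟨hA, hx, hy⟩, ?_⟩
    rintro B ⟨hB, hx', hy'⟩
    exact (subset_of_initialVertex_eq hA (hcompl B hB) (hx'.symm.trans hx)
      (hy'.symm.trans hy)).antisymm
      (subset_of_initialVertex_eq hB (hcompl A hA) (hx.symm.trans hx') (hy.symm.trans hy'))

end StructureTree

end CutTree

namespace CutTree

variable {V : Type*} {G : SimpleGraph V} {c : G.edgeSet → ℕ+} {A B C : Set V}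

/-! ### Nestedness and crossing numbers of corners. -/

section Nested

theorem nested_comm : Nested A B ↔ Nested B A := by
  simp only [Nested, Set.inter_comm]
  tauto

theorem nested_compl_left : Nested Aᶜ B ↔ Nested A B := by
  simp only [Nested, compl_compl]
  tauto

theorem nested_compl_right : Nested A Bᶜ ↔ Nested A B := by
  simp only [Nested, compl_compl]
  tauto

theorem nested_inter_right (A B : Set V) : Nested (A ∩ B) B :=
  nested_iff.2 (Or.inr (Or.inr (Or.inl Set.inter_subset_right)))

/-- A set nested with two crossing sets is nested with each of their corners. -/
theorem Nested.inter (hAB : ¬ Nested A B) (hA : Nested A C) (hB : Nested B C) :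
    Nested (A ∩ B) C := by
  rw [nested_iff] at hA hB hAB ⊢
  push Not at hAB
  rcases hA with h | h | h | h
  · exact Or.inl (Set.inter_subset_left.trans h)
  · rcases hB with h' | h' | h' | h'
    · exact Or.inl (Set.inter_subset_right.trans h')
    · exact Or.inr (Or.inl (Set.subset_inter h h'))
    · exact Or.inr (Or.inr (Or.inl (Set.inter_subset_right.trans h')))
    · exact absurd (Set.compl_subset_comm.1 (h'.trans h)) hAB.2.2.2
  · exact Or.inr (Or.inr (Or.inl (Set.inter_subset_left.trans h)))
  · rcases hB with h' | h' | h' | h'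
    · exact Or.inl (Set.inter_subset_right.trans h')
    · exact absurd (h.trans h') hAB.2.2.2
    · exact Or.inr (Or.inr (Or.inl (Set.inter_subset_right.trans h')))
    · refine Or.inr (Or.inr (Or.inr ?_))
      rw [Set.compl_inter]
      exact Set.union_subset h h'

/-- Consequently a set crossing both of two opposite corners of `A` and `B` crosses both `A` and
`B`. -/
theorem Nested.inter_or (hA : Nested A C) (B : Set V) :
    Nested (A ∩ B) C ∨ Nested (Aᶜ ∩ Bᶜ) C := by
  have h1 : A ∩ B ⊆ A := Set.inter_subset_left
  have h2 : Aᶜ ∩ Bᶜ ⊆ Aᶜ := Set.inter_subset_left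
  rw [nested_iff] at hA
  rw [nested_iff, nested_iff]
  rcases hA with h | h | h | h
  · exact Or.inl (Or.inl (h1.trans h))
  · exact Or.inr (Or.inl (h2.trans (Set.compl_subset_compl.2 h)))
  · exact Or.inl (Or.inr (Or.inr (Or.inl (h1.trans h))))
  · exact Or.inr (Or.inr (Or.inr (Or.inl (h2.trans h))))

theorem crossingNumber_eq_zero {𝒞 : Set (Set V)} :
    crossingNumber A 𝒞 = 0 ↔ ∀ C ∈ 𝒞, Nested A C := by
  simp [crossingNumber, Set.encard_eq_zero, Set.eq_empty_iff_forall_notMem]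

theorem crossingNumber_compl (A : Set V) (𝒞 : Set (Set V)) :
    crossingNumber Aᶜ 𝒞 = crossingNumber A 𝒞 := by
  simp only [crossingNumber, nested_compl_left]

/-- Whatever crosses one of the corners crosses `A` or `B`, and whatever crosses both corners
crosses both `A` and `B`; counting unions and intersections gives `≤`. Strictness comes from `B`
itself, which crosses `A` but neither corner. -/
theorem crossingNumber_corners_lt {𝒟 : Set (Set V)} (hB : B ∈ 𝒟)
    (hAB : ¬ Nested A B) (hfA : {C ∈ 𝒟 | ¬ Nested A C}.Finite)
    (hfB : {C ∈ 𝒟 | ¬ Nested B C}.Finite) :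
    crossingNumber (A ∩ B) 𝒟 + crossingNumber (Aᶜ ∩ Bᶜ) 𝒟 <
      crossingNumber A 𝒟 + crossingNumber B 𝒟 := by
  have hAB' : ¬ Nested Aᶜ Bᶜ := by rwa [nested_compl_left, nested_compl_right]
  have hsub : {C ∈ 𝒟 | ¬ Nested (A ∩ B) C} ∪ {C ∈ 𝒟 | ¬ Nested (Aᶜ ∩ Bᶜ) C} ⊂
      {C ∈ 𝒟 | ¬ Nested A C} ∪ {C ∈ 𝒟 | ¬ Nested B C} := by
    constructor
    · rintro C (⟨hC, h⟩ | ⟨hC, h⟩)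
      · by_contra hne
        simp only [Set.mem_union, Set.mem_ofPred_eq, hC, true_and, not_or, not_not] at hne
        exact h (Nested.inter hAB hne.1 hne.2)
      · by_contra hne
        simp only [Set.mem_union, Set.mem_ofPred_eq, hC, true_and, not_or, not_not] at hne
        exact h (Nested.inter hAB' (nested_compl_left.2 hne.1) (nested_compl_left.2 hne.2))
    · intro h
      rcases h (Or.inl ⟨hB, hAB⟩) with h | h
      · exact h.2 (nested_inter_right A B)
      · exact h.2 (nested_compl_right.1 (nested_inter_right Aᶜ Bᶜ))
  have hsub' : {C ∈ 𝒟 | ¬ Nested (A ∩ B) C} ∩ {C ∈ 𝒟 | ¬ Nested (Aᶜ ∩ Bᶜ) C} ⊆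
      {C ∈ 𝒟 | ¬ Nested A C} ∩ {C ∈ 𝒟 | ¬ Nested B C} := by
    rintro C ⟨⟨hC, h1⟩, -, h2⟩
    refine ⟨⟨hC, fun h => (h.inter_or B).elim h1 h2⟩, hC, fun h => ?_⟩
    rw [Set.inter_comm] at h1 h2
    exact (h.inter_or A).elim h1 h2
  have hfin := hfA.union hfB
  simp only [crossingNumber]
  rw [← Set.encard_union_add_encard_inter,
    ← Set.encard_union_add_encard_inter {C ∈ 𝒟 | ¬ Nested A C}]
  have hne : ({C ∈ 𝒟 | ¬ Nested (A ∩ B) C} ∩ {C ∈ 𝒟 | ¬ Nested (Aᶜ ∩ Bᶜ) C}).encard ≠ ⊤ :=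
    Set.encard_ne_top_iff.2 ((hfA.inter_of_left _).subset hsub')
  exact ENat.add_lt_add_of_lt_of_le hne ((hfin.subset hsub.1).encard_lt_encard hsub)
    (Set.encard_le_encard hsub')

end Nested

/-! ### Uncrossing: nestedness of the stages and existence of thin members. -/

section Stages

/-- Otherwise submodularity makes `A ∪ E` and `Aᶜ ∪ E` both cheaper than `E`. But whichever of `x`,
`y` is outside `E` is also outside one of these unions, which therefore separates `x` from `y`,
against thinness of `E`. -/
theorem IsThinFor.capacity_inter_le {E : Set V} {x y : V ⊕ EdgeEnd G} (hE : IsThinFor c E x y)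
    (hA : IsCut G A) : capacity c (A ∩ E) ≤ capacity c A ∨ capacity c (Aᶜ ∩ E) ≤ capacity c A := by
  have h1 := capacity_inter_add_capacity_union_le c hA hE.1
  have h2 := capacity_inter_add_capacity_union_le c hA.compl hE.1
  rw [capacity_compl] at h2
  have h3 := hE.2.2 (A ∪ E) (hA.union hE.1)
  have h4 := hE.2.2 (Aᶜ ∪ E) (hA.compl.union hE.1)
  have h5 := hE.2.1
  rw [separates_iff hE.1] at h5
  rw [separates_iff (hA.union hE.1), liesIn_union hA hE.1, liesIn_union hA hE.1] at h3
  rw [separates_iff (hA.compl.union hE.1), liesIn_union hA.compl hE.1, liesIn_union hA.compl hE.1,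
    liesIn_compl hA, liesIn_compl hA] at h4
  by_cases hx : LiesIn A x <;> by_cases hy : LiesIn A y <;> by_cases hx' : LiesIn E x <;>
    by_cases hy' : LiesIn E y <;> simp only [hx, hy, hx', hy', not_true, not_false_eq_true,
      or_true, or_false, or_self, iff_true, iff_false, iff_self, forall_const,
      false_imp_iff] at h3 h4 h5 <;> omega

theorem stage_mono (c : G.edgeSet → ℕ+) : Monotone (stage c) := by
  refine monotone_nat_of_le_succ fun n => ?_
  rcases n with _ | n
  · exact Set.empty_subset _
  · exact Set.subset_union_left

theorem exists_isThinFor_of_mem_stage {n : ℕ} (h : A ∈ stage c n) :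
    (∃ u v, IsThinFor c A u v) ∧ capacity c A ≤ n := by
  induction n using Nat.strong_induction_on with
  | _ n ih =>
    match n, h with
    | 0, h => exact absurd h (Set.notMem_empty A)
    | 1, h => exact ⟨h.1, h.2.le⟩
    | n + 2, h =>
      rcases h with h | h
      · have := ih (n + 1) (by omega) h
        exact ⟨this.1, this.2.trans (by omega)⟩
      · exact ⟨h.1.1.1, h.1.1.2.le⟩

theorem isBond_of_mem_stage (hG : G.Connected) {n : ℕ} (h : A ∈ stage c n) : IsBond G A := by
  obtain ⟨⟨u, v, h⟩, -⟩ := exists_isThinFor_of_mem_stage h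
  exact h.isBond hG

theorem compl_mem_thinCuts {n : ℕ} (h : A ∈ thinCuts c n) : Aᶜ ∈ thinCuts c n := by
  obtain ⟨⟨u, v, h⟩, hn⟩ := h
  exact ⟨⟨u, v, h.compl⟩, by rwa [capacity_compl]⟩

theorem compl_mem_stage {n : ℕ} (h : A ∈ stage c n) : Aᶜ ∈ stage c n := by
  induction n using Nat.strong_induction_on with
  | _ n ih =>
    match n, h with
    | 0, h => exact absurd h (Set.notMem_empty A)
    | 1, h => exact compl_mem_thinCuts h
    | n + 2, h =>
      rcases h with h | ⟨⟨h, h0⟩, u, v, huv, hmin⟩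
      · exact Or.inl (ih (n + 1) (by omega) h)
      · exact Or.inr ⟨⟨compl_mem_thinCuts h, by rwa [crossingNumber_compl]⟩, u, v, huv.compl,
          by rwa [crossingNumber_compl]⟩

theorem finite_crossing_of_subset (hG : G.Connected) (hA : IsCut G A) {n : ℕ} {𝒟 : Set (Set V)}
    (h : ∀ B ∈ 𝒟, (∃ u v, IsThinFor c B u v) ∧ capacity c B ≤ n) :
    {C ∈ 𝒟 | ¬ Nested A C}.Finite := by
  refine (hA.finite_crossing_bonds c n).subset ?_
  rintro B ⟨hB, hAB⟩
  obtain ⟨⟨u, v, huv⟩, hn⟩ := h B hB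
  exact ⟨huv.isBond hG, hn, hAB⟩

/-- If `A` and `B` crossed, connectedness of `A` and `Aᶜ` would put one edge of the coboundary of
`B` inside each, but there is only one edge. -/
theorem nested_of_mem_thinCuts_one (hG : G.Connected) (hA : A ∈ thinCuts c 1)
    (hB : B ∈ thinCuts c 1) : Nested A B := by
  by_contra h
  obtain ⟨⟨u, v, hA⟩, -⟩ := hA
  obtain ⟨⟨x, y, hB⟩, hB1⟩ := hB
  have key : ∀ A, ConnectedSet G A → ¬ Nested A B →
      ∃ e : G.edgeSet, e ∈ coboundary G B ∧ ∀ z ∈ e.1, z ∈ A := by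
    intro A hA h
    have h1 : (A ∩ B).Nonempty := by
      by_contra h'
      exact h (Or.inl (Set.not_nonempty_iff_eq_empty.1 h'))
    have h2 : (A \ (A ∩ B)).Nonempty := by
      rw [Set.sdiff_self_inter]
      by_contra h'
      exact h (Or.inr (Or.inr (Or.inl (Set.not_nonempty_iff_eq_empty.1 h'))))
    obtain ⟨p, hp, q, hq, hpq⟩ := hA (A ∩ B) Set.inter_subset_left h1 h2
    refine ⟨⟨s(p, q), hpq⟩, (mk_mem_coboundary hpq).2 (Or.inl ⟨hp.2, fun hqB => hq.2 ⟨hq.1, hqB⟩⟩),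
      ?_⟩
    intro z hz
    rcases Sym2.mem_iff.1 hz with rfl | rfl
    · exact hp.1
    · exact hq.1
  obtain ⟨e, he, heA⟩ := key A (hA.connectedSet hG) h
  obtain ⟨f, hf, hfA⟩ := key Aᶜ (hA.compl.connectedSet hG) (by rwa [nested_compl_left])
  have hle := ncard_coboundary_le_capacity c hB.1
  rw [hB1, Set.ncard_le_one hB.1] at hle
  obtain rfl := hle e he f hf
  obtain ⟨z, hz, -⟩ := he.1
  exact hfA z hz (heA z hz)

/-- Each of the two opposite corners costs at least `n`, and by submodularity they cost at most `2n`
together, so both cost exactly `n` and are thin. They stay nested with `ℰ`, so the lower bounds `a`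
and `b` apply to them. The two pairs of points may coincide. -/
theorem crossing_corners_thin (hG : G.Connected) {n : ℕ} {ℰ : Set (Set V)}
    {u v x y : V ⊕ EdgeEnd G}
    (hA : A ∈ {A ∈ thinCuts c n | crossingNumber A ℰ = 0})
    (hB : B ∈ {A ∈ thinCuts c n | crossingNumber A ℰ = 0})
    (hAB : ¬ Nested A B)
    (hu : ∀ S, IsCut G S → Separates S u v → n ≤ capacity c S)
    (hx : ∀ S, IsCut G S → Separates S x y → n ≤ capacity c S)
    (hAu : Separates (A ∩ B) u v) (hBx : Separates (Aᶜ ∩ Bᶜ) x y) {a b : ℕ∞}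
    (ha : ∀ D ∈ {A ∈ thinCuts c n | crossingNumber A ℰ = 0}, IsThinFor c D u v →
      a ≤ crossingNumber D {A ∈ thinCuts c n | crossingNumber A ℰ = 0})
    (hb : ∀ D ∈ {A ∈ thinCuts c n | crossingNumber A ℰ = 0}, IsThinFor c D x y →
      b ≤ crossingNumber D {A ∈ thinCuts c n | crossingNumber A ℰ = 0}) :
    a + b < crossingNumber A {A ∈ thinCuts c n | crossingNumber A ℰ = 0} +
      crossingNumber B {A ∈ thinCuts c n | crossingNumber A ℰ = 0} := by
  set 𝒟 := {A ∈ thinCuts c n | crossingNumber A ℰ = 0}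
  obtain ⟨⟨⟨_, _, hA1, -⟩, hAn⟩, hA0⟩ := id hA
  obtain ⟨⟨⟨_, _, hB1, -⟩, hBn⟩, hB0⟩ := id hB
  rw [crossingNumber_eq_zero] at hA0 hB0
  have hAB' : ¬ Nested Aᶜ Bᶜ := by rwa [nested_compl_left, nested_compl_right]
  have h1 := hu _ (hA1.inter hB1) hAu
  have h2 := hx _ (hA1.compl.inter hB1.compl) hBx
  have h3 := capacity_inter_add_capacity_union_le c hA1 hB1
  rw [← capacity_compl (A ∪ B), Set.compl_union] at h3
  have hK : IsThinFor c (A ∩ B) u v :=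
    ⟨hA1.inter hB1, hAu, fun S hS hS' => le_trans (by omega) (hu S hS hS')⟩
  have hL : IsThinFor c (Aᶜ ∩ Bᶜ) x y :=
    ⟨hA1.compl.inter hB1.compl, hBx, fun S hS hS' => le_trans (by omega) (hx S hS hS')⟩
  have hK' : A ∩ B ∈ 𝒟 := ⟨⟨⟨u, v, hK⟩, by omega⟩, crossingNumber_eq_zero.2 fun C hC =>
    Nested.inter hAB (hA0 C hC) (hB0 C hC)⟩
  have hL' : Aᶜ ∩ Bᶜ ∈ 𝒟 := ⟨⟨⟨x, y, hL⟩, by omega⟩, crossingNumber_eq_zero.2 fun C hC =>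
    Nested.inter hAB' (nested_compl_left.2 (hA0 C hC)) (nested_compl_left.2 (hB0 C hC))⟩
  have hfin {A} (hA : IsCut G A) : {C ∈ 𝒟 | ¬ Nested A C}.Finite :=
    finite_crossing_of_subset (n := n) hG hA fun B hB => ⟨hB.1.1, hB.1.2.le⟩
  exact (add_le_add (ha _ hK' hK) (hb _ hL' hL)).trans_lt
    (crossingNumber_corners_lt hB hAB (hfin hA1) (hfin hB1))

theorem nested_of_mem_optimallyNested (hG : G.Connected) {n : ℕ} {ℰ : Set (Set V)}
    (hA : A ∈ optimallyNested c {A ∈ thinCuts c n | crossingNumber A ℰ = 0})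
    (hB : B ∈ optimallyNested c {A ∈ thinCuts c n | crossingNumber A ℰ = 0}) : Nested A B := by
  by_contra hAB
  obtain ⟨hA, u, v, huv, ha⟩ := hA
  obtain ⟨hB, x, y, hxy, hb⟩ := hB
  have hAn : capacity c A = n := hA.1.2
  have hBn : capacity c B = n := hB.1.2
  have hu := huv.2.2
  have hx := hxy.2.2
  rw [hAn] at hu
  rw [hBn] at hx
  have hB' : Bᶜ ∈ {A ∈ thinCuts c n | crossingNumber A ℰ = 0} :=
    ⟨compl_mem_thinCuts hB.1, by rw [crossingNumber_compl]; exact hB.2⟩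
  have hAB' : ¬ Nested A Bᶜ := by rwa [nested_compl_right]
  have hfin {A} (hA : IsCut G A) :
      crossingNumber A {A ∈ thinCuts c n | crossingNumber A ℰ = 0} ≠ ⊤ :=
    Set.encard_ne_top_iff.2
      (finite_crossing_of_subset (n := n) hG hA fun B hB => ⟨hB.1.1, hB.1.2.le⟩)
  have c1 := hfin huv.1
  have c2 := hfin hxy.1
  -- With `a`, `b` the crossing numbers of `A`, `B`: `k1` to `k4` cover opposite corners of which
  -- one separates `u, v` and the other `x, y`, giving `a + b < a + b`. In `k5` to `k8` both corners
  -- separate the same pair, giving `a < b` or `b < a`.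
  have k1 := fun h1 h2 => crossing_corners_thin hG hA hB hAB hu hx h1 h2 ha hb
  have k2 := fun h1 h2 => crossing_corners_thin hG hA hB hAB hx hu h1 h2 hb ha
  have k3 := fun h1 h2 => crossing_corners_thin hG hA hB' hAB' hu hx h1 h2 ha hb
  have k4 := fun h1 h2 => crossing_corners_thin hG hA hB' hAB' hx hu h1 h2 hb ha
  have k5 := fun h1 h2 => crossing_corners_thin hG hA hB hAB hu hu h1 h2 ha ha
  have k6 := fun h1 h2 => crossing_corners_thin hG hA hB' hAB' hx hx h1 h2 hb hb
  have k7 := fun h1 h2 => crossing_corners_thin hG hA hB' hAB' hu hu h1 h2 ha ha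
  have k8 := fun h1 h2 => crossing_corners_thin hG hA hB hAB hx hx h1 h2 hb hb
  have s1 := huv.2.1
  have s2 := hxy.2.1
  rw [compl_compl, crossingNumber_compl] at k3 k4 k6 k7
  generalize crossingNumber A {A ∈ thinCuts c n | crossingNumber A ℰ = 0} = a at *
  generalize crossingNumber B {A ∈ thinCuts c n | crossingNumber A ℰ = 0} = b at *
  lift a to ℕ using c1
  lift b to ℕ using c2
  norm_cast at k1 k2 k3 k4 k5 k6 k7 k8
  replace k1 := fun h1 h2 => lt_irrefl _ (k1 h1 h2)
  replace k2 := fun h1 h2 => (k2 h1 h2).ne (add_comm b a)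
  replace k3 := fun h1 h2 => lt_irrefl _ (k3 h1 h2)
  replace k4 := fun h1 h2 => (k4 h1 h2).ne (add_comm b a)
  replace k5 := fun h1 h2 h3 h4 =>
    lt_asymm (Nat.add_lt_add_iff_left.1 (k5 h1 h2)) (Nat.add_lt_add_iff_right.1 (k6 h3 h4))
  replace k7 := fun h1 h2 h3 h4 =>
    lt_asymm (Nat.add_lt_add_iff_left.1 (k7 h1 h2)) (Nat.add_lt_add_iff_right.1 (k8 h3 h4))
  clear k6 k8
  have i1 := huv.1.inter hxy.1
  have i2 := huv.1.compl.inter hxy.1.compl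
  have i3 := huv.1.inter hxy.1.compl
  have i4 := huv.1.compl.inter hxy.1
  simp only [separates_iff, huv.1, hxy.1, i1, i2, i3, i4, liesIn_inter, liesIn_compl] at *
  clear ha hb hu hx hA hB hB' hfin
  -- The paired inequalities are needed only when `u, v` occupy one diagonal pair of corners and `x,
  -- y` the other.
  by_cases h1 : LiesIn A u <;> by_cases h2 : LiesIn A v <;> by_cases h3 : LiesIn A x <;>
    by_cases h4 : LiesIn A y <;> by_cases h5 : LiesIn B u <;> by_cases h6 : LiesIn B v <;>
    by_cases h7 : LiesIn B x <;> by_cases h8 : LiesIn B y <;>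
    simp [h1, h2, h3, h4, h5, h6, h7, h8] at k1 k2 k3 k4 k5 k7 s1 s2

theorem nested_of_mem_stage (hG : G.Connected) (n : ℕ) :
    ∀ A ∈ stage c n, ∀ B ∈ stage c n, Nested A B := by
  induction n using Nat.strong_induction_on with
  | _ n ih =>
    intro A hA B hB
    match n, hA, hB with
    | 0, hA, _ => exact absurd hA (Set.notMem_empty A)
    | 1, hA, hB => exact nested_of_mem_thinCuts_one hG hA hB
    | n + 2, hA, hB =>
      rcases hA with hA | hA <;> rcases hB with hB | hB
      · exact ih (n + 1) (by omega) A hA B hB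
      · exact nested_comm.1 (crossingNumber_eq_zero.1 hB.1.2 A hA)
      · exact crossingNumber_eq_zero.1 hA.1.2 B hB
      · exact nested_of_mem_optimallyNested hG hA hB

/-- A cut that is thin for `u, v` can be chosen to cross no member of the stages of smaller
capacity. -/
theorem exists_isThinFor_nested (hG : G.Connected) {n : ℕ} {u v : V ⊕ EdgeEnd G}
    (hA : IsThinFor c A u v) (hn : n < capacity c A) :
    ∃ B, IsThinFor c B u v ∧ capacity c B = capacity c A ∧ crossingNumber B (stage c n) = 0 := by
  induction hk : {C ∈ stage c n | ¬ Nested A C}.ncard using Nat.strong_induction_on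
    generalizing A with
  | _ k ih =>
    by_cases h0 : ∀ C ∈ stage c n, Nested A C
    · exact ⟨A, hA, rfl, crossingNumber_eq_zero.2 h0⟩
    push Not at h0
    obtain ⟨B, hB, hAB⟩ := h0
    have hf : {C ∈ stage c n | ¬ Nested A C}.Finite :=
      finite_crossing_of_subset (n := n) hG hA.1 fun B hB => exists_isThinFor_of_mem_stage hB
    -- The corner crosses nothing that `A'` does not, since `B'` is nested with its own stage, and
    -- it no longer crosses `B'`; so the induction applies to it.
    have key : ∀ A' B', IsCut G A' →
        {C ∈ stage c n | ¬ Nested A' C} = {C ∈ stage c n | ¬ Nested A C} →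
        B' ∈ stage c n → ¬ Nested A' B' → Separates (A' ∩ B') u v →
        capacity c (A' ∩ B') ≤ capacity c A →
        ∃ B, IsThinFor c B u v ∧ capacity c B = capacity c A ∧
          crossingNumber B (stage c n) = 0 := by
      intro A' B' hA' hcross hB' hAB' hsep hle
      obtain ⟨⟨x, y, hxy⟩, -⟩ := exists_isThinFor_of_mem_stage hB'
      have hi : IsThinFor c (A' ∩ B') u v :=
        ⟨hA'.inter hxy.1, hsep, fun S hS hS' => hle.trans (hA.2.2 S hS hS')⟩
      have hcap' : capacity c (A' ∩ B') = capacity c A := hle.antisymm (hA.2.2 _ hi.1 hsep)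
      have hlt : {C ∈ stage c n | ¬ Nested (A' ∩ B') C}.ncard < k := by
        rw [← hk]
        refine Set.ncard_lt_ncard ?_ hf
        rw [← hcross]
        refine ⟨fun C ⟨hC, h⟩ => ⟨hC, fun h' => h (Nested.inter hAB' h' ?_)⟩, fun h => ?_⟩
        · exact nested_of_mem_stage hG n B' hB' C hC
        · exact (h ⟨hB', hAB'⟩).2 (nested_inter_right A' B')
      rw [← hcap'] at hn
      obtain ⟨D, h1, h2, h3⟩ := ih _ hlt hi hn rfl
      exact ⟨D, h1, h2.trans hcap', h3⟩
    -- `B` is cheaper than the thin cut `A`, so `u` and `v` lie on the same side of `B`. Both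
    -- corners on that side separate them, and one costs no more than `A`.
    have hsB : ¬ Separates B u v := by
      obtain ⟨⟨x, y, hxy⟩, hBn⟩ := exists_isThinFor_of_mem_stage hB
      intro h
      have := hA.2.2 B hxy.1 h
      omega
    have key' : ∀ B', B' ∈ stage c n → ¬ Nested A B' → LiesIn B' u → LiesIn B' v →
        ∃ B, IsThinFor c B u v ∧ capacity c B = capacity c A ∧
          crossingNumber B (stage c n) = 0 := by
      intro B' hB' hAB' hu hv
      obtain ⟨⟨x, y, hxy⟩, -⟩ := exists_isThinFor_of_mem_stage hB'
      have hs := hA.2.1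
      rw [separates_iff hA.1] at hs
      rcases hxy.capacity_inter_le hA.1 with h | h
      · refine key A B' hA.1 rfl hB' hAB' ?_ h
        rw [separates_iff (hA.1.inter hxy.1), liesIn_inter, liesIn_inter]
        tauto
      · refine key Aᶜ B' hA.1.compl ?_ hB' ?_ ?_ h
        · simp only [nested_compl_left]
        · rwa [nested_compl_left]
        · rw [separates_iff (hA.1.compl.inter hxy.1), liesIn_inter, liesIn_inter, liesIn_compl hA.1,
            liesIn_compl hA.1]
          tauto
    obtain ⟨⟨x, y, hxy⟩, -⟩ := exists_isThinFor_of_mem_stage hB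
    rw [separates_iff hxy.1, not_not] at hsB
    by_cases hu : LiesIn B u
    · exact key' B hB hAB hu (hsB.1 hu)
    · refine key' Bᶜ (compl_mem_stage hB) (by rwa [nested_compl_right]) ?_ ?_
      · rwa [liesIn_compl hxy.1]
      · rw [liesIn_compl hxy.1]
        tauto

/-- Points separated by a cut of capacity at most `n` are separated by a thin cut in `stage c n`. -/
theorem exists_mem_stage_isThinFor (hG : G.Connected) {n : ℕ} {u v : V ⊕ EdgeEnd G}
    (hA : IsCut G A) (hs : Separates A u v) (hn : capacity c A ≤ n) :
    ∃ B ∈ stage c n, IsThinFor c B u v := by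
  obtain ⟨B, hB⟩ := exists_isThinFor (c := c) hA hs
  suffices h : ∃ D ∈ stage c (capacity c B), IsThinFor c D u v by
    obtain ⟨D, hD, hD'⟩ := h
    exact ⟨D, stage_mono c ((hB.2.2 A hA hs).trans hn) hD, hD'⟩
  have hpos := hB.capacity_pos hG
  match hm : capacity c B with
  | 0 => omega
  | 1 => exact ⟨B, ⟨⟨u, v, hB⟩, hm⟩, hB⟩
  | m + 2 =>
    obtain ⟨D, hD, hDc, hD0⟩ := exists_isThinFor_nested (n := m + 1) hG hB (by omega)
    obtain ⟨E, ⟨hE, hE'⟩, hmin⟩ := (InvImage.wf (fun E => crossingNumber E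
      {A ∈ thinCuts c (m + 2) | crossingNumber A (stage c (m + 1)) = 0}) wellFounded_lt).has_min
      {E ∈ {A ∈ thinCuts c (m + 2) | crossingNumber A (stage c (m + 1)) = 0} | IsThinFor c E u v}
      ⟨D, ⟨⟨⟨u, v, hD⟩, hDc.trans hm⟩, hD0⟩, hD⟩
    exact ⟨E, Or.inr ⟨hE, u, v, hE', fun S hS hS' => not_lt.1 (hmin S ⟨hS, hS'⟩)⟩, hE'⟩

theorem isDirectedEdgeSetOfTree_stage (hG : G.Connected) (c : G.edgeSet → ℕ+) (n : ℕ) :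
    IsDirectedEdgeSetOfTree (stage c n) := by
  have hne : ∀ A ∈ stage c n, A.Nonempty := by
    intro A hA
    obtain ⟨⟨u, v, h⟩, -⟩ := exists_isThinFor_of_mem_stage hA
    exact h.nonempty
  refine isDirectedEdgeSetOfTree hne (fun A hA => compl_mem_stage hA) (nested_of_mem_stage hG n) ?_
  intro A hA B hB
  -- Every member between `A` and `B` separates a fixed vertex of `A` from a fixed vertex outside
  -- `B`.
  obtain ⟨x, hx⟩ := hne A hA
  obtain ⟨y, hy⟩ := hne _ (compl_mem_stage hB)
  refine (finite_bonds_separating c n x y).subset ?_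
  rintro C ⟨hC, h1, h2⟩
  exact ⟨isBond_of_mem_stage hG hC, (exists_isThinFor_of_mem_stage hC).2, h1 hx, fun h => hy (h2 h)⟩

end Stages

end CutTree

namespace CutTree

variable {V : Type*} {G : SimpleGraph V} {c : G.edgeSet → ℕ+} {A B C : Set V}

/-! ### Rays converging along decreasing connected sets. -/

section Rays

/-- The vertices of `A` that can be joined to `B` by a path of length at most `k` in `A`. -/
def layer (G : SimpleGraph V) (A B : Set V) : ℕ → Set V
  | 0 => B
  | k + 1 => layer G A B k ∪ {x ∈ A | ∃ y ∈ layer G A B k, G.Adj x y}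

theorem layer_subset (hBA : B ⊆ A) (k : ℕ) : layer G A B k ⊆ A := by
  induction k with
  | zero => exact hBA
  | succ k ih => exact Set.union_subset ih fun x hx => hx.1

theorem ConnectedSet.exists_mem_layer (hA : ConnectedSet G A) (hBA : B ⊆ A) (hB : B.Nonempty)
    {x : V} (hx : x ∈ A) : ∃ k, x ∈ layer G A B k := by
  by_contra h
  obtain ⟨y, hy, z, hz, hyz⟩ := hA (⋃ k, layer G A B k) (Set.iUnion_subset (layer_subset hBA))
    (hB.mono (Set.subset_iUnion (layer G A B) 0)) ⟨x, hx, by simpa using h⟩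
  obtain ⟨k, hk⟩ := Set.mem_iUnion.1 hy
  exact hz.2 (Set.mem_iUnion.2 ⟨k + 1, Or.inr ⟨hz.1, y, hk, hyz.symm⟩⟩)

/-- A decreasing sequence of nonempty connected sets with empty intersection contains a ray that is
eventually in each of the sets. -/
theorem exists_ray_of_antitone {C : ℕ → Set V} (hanti : Antitone C) (hne : ∀ j, (C j).Nonempty)
    (hconn : ∀ j, ConnectedSet G (C j)) (hempty : ∀ x, ∃ j, x ∉ C j) :
    ∃ R : Ray G, ∀ j, ∀ᶠ n in atTop, R.toFun n ∈ C j := by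
  classical
  -- The shift by one makes the least such `j`, called `level x`, the last index with `x ∈ C j`.
  have hlevel : ∀ x : C 0, ∃ j, x.1 ∉ C (j + 1) := fun x => by
    obtain ⟨j, hj⟩ := hempty x
    exact ⟨j, fun h => hj (hanti (Nat.le_succ j) h)⟩
  let level : C 0 → ℕ := fun x => Nat.find (hlevel x)
  have level_not : ∀ x, x.1 ∉ C (level x + 1) := fun x => Nat.find_spec (hlevel x)
  have le_level : ∀ {x : C 0} {j}, x.1 ∈ C j → j ≤ level x := fun {x j} hx => by
    by_contra h
    exact level_not x (hanti (by omega) hx)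
  have level_mem : ∀ x : C 0, x.1 ∈ C (level x) := fun x => by
    rcases h : level x with _ | j
    · exact x.2
    · have := Nat.find_min (hlevel x) (m := j) (by change j < level x; omega)
      exact not_not.1 this
  have hdepth : ∀ x : C 0, ∃ k, x.1 ∈ layer G (C (level x)) (C (level x + 1)) k := fun x =>
    (hconn _).exists_mem_layer (hanti (Nat.le_succ _)) (hne _) (level_mem x)
  let depth : C 0 → ℕ := fun x => Nat.find (hdepth x)
  -- Here `depth` is the distance, inside the current set, to the next one. Every step raises the
  -- level, or keeps it and lowers the depth; so vertices never repeat and no level lasts forever.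
  let r : C 0 → C 0 → Prop := fun x y => level x < level y ∨ level x = level y ∧ depth y < depth x
  have r_trans : ∀ x y z, r x y → r y z → r x z := by
    intro x y z h1 h2
    simp only [r] at *
    omega
  have step : ∀ x : C 0, ∃ y : C 0, G.Adj x y ∧ r x y := by
    intro x
    have hx : x.1 ∈ layer G (C (level x)) (C (level x + 1)) (depth x) := Nat.find_spec (hdepth x)
    rcases hd : depth x with _ | k
    · rw [hd] at hx
      exact absurd hx (level_not x)
    · have hk : x.1 ∉ layer G (C (level x)) (C (level x + 1)) k :=
        Nat.find_min (hdepth x) (by change k < depth x; omega)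
      rw [hd] at hx
      obtain ⟨-, y, hy, hxy⟩ := hx.resolve_left hk
      have hyC : y ∈ C (level x) := layer_subset (hanti (Nat.le_succ _)) _ hy
      let y' : C 0 := ⟨y, hanti (Nat.zero_le _) hyC⟩
      refine ⟨y', hxy, ?_⟩
      rcases (le_level (x := y') hyC).lt_or_eq with h | h
      · exact Or.inl h
      · refine Or.inr ⟨h, ?_⟩
        rw [hd, Nat.lt_succ_iff]
        refine Nat.find_min' (hdepth y') ?_
        rwa [← h]
  choose next hadj hr using step
  obtain ⟨x₀, hx₀⟩ := hne 0
  let f : ℕ → C 0 := fun n => next^[n] ⟨x₀, hx₀⟩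
  have f_succ : ∀ n, f (n + 1) = next (f n) := fun n => Function.iterate_succ_apply' _ _ _
  have : IsTrans (C 0) r := ⟨r_trans⟩
  have f_lt : ∀ {m n}, m < n → r (f m) (f n) := fun {m n} hmn =>
    Nat.rel_of_forall_rel_succ_of_lt r (fun n => by rw [f_succ]; exact hr _) hmn
  have f_inj : ∀ {m n}, m < n → (f m).1 ≠ f n := fun {m n} hmn h => by
    have h1 := f_lt hmn
    rw [Subtype.ext h] at h1
    simp only [r] at h1
    omega
  have level_mono : Monotone fun n => level (f n) := monotone_nat_of_le_succ fun n => by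
    have := f_lt (Nat.lt_succ_self n)
    simp only [r] at this
    change level (f n) ≤ level (f (n + 1))
    simp only [Nat.succ_eq_add_one] at this
    omega
  have unbounded : ∀ j, ∃ n, j ≤ level (f n) := by
    intro j
    induction j with
    | zero => exact ⟨0, Nat.zero_le _⟩
    | succ j ih =>
      obtain ⟨n, hn⟩ := ih
      by_contra! hlt
      have : ∀ k, depth (f (n + k)) + k ≤ depth (f n) := by
        intro k
        induction k with
        | zero => rfl
        | succ k ih =>
          have h1 := f_lt (Nat.lt_succ_self (n + k))
          have h2 := level_mono (Nat.le_add_right n k)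
          have h3 := hlt (n + k + 1)
          simp only [r, Nat.succ_eq_add_one] at h1 h2
          change depth (f (n + k + 1)) + (k + 1) ≤ depth (f n)
          omega
      have := this (depth (f n) + 1)
      omega
  refine ⟨⟨fun n => f n, ?_, fun n => ?_⟩, fun j => ?_⟩
  · intro m n h
    rcases lt_trichotomy m n with hmn | hmn | hmn
    · exact absurd h (f_inj hmn)
    · exact hmn
    · exact absurd h.symm (f_inj hmn)
  · rw [f_succ]
    exact hadj _
  · obtain ⟨N, hN⟩ := unbounded j
    filter_upwards [eventually_ge_atTop N] with n hn
    exact hanti (hN.trans (level_mono hn)) (level_mem (f n))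

end Rays

/-! ### Compactness of the space of vertices and ends. -/

section Compactness

/-- `A` is covered by finitely many members of `𝒰`. -/
def FinitelyCovered (𝒰 : Set (Set V)) (A : Set V) : Prop :=
  ∃ 𝓕 ⊆ 𝒰, 𝓕.Finite ∧ A ⊆ ⋃₀ 𝓕

theorem FinitelyCovered.union {𝒰 : Set (Set V)} (hA : FinitelyCovered 𝒰 A)
    (hB : FinitelyCovered 𝒰 B) : FinitelyCovered 𝒰 (A ∪ B) := by
  obtain ⟨F, hF, hF', hFA⟩ := hA
  obtain ⟨E, hE, hE', hEB⟩ := hB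
  refine ⟨F ∪ E, Set.union_subset hF hE, hF'.union hE', ?_⟩
  rw [Set.sUnion_union]
  exact Set.union_subset_union hFA hEB

theorem FinitelyCovered.of_diff {𝒰 𝓕 : Set (Set V)} (h𝓕 : 𝓕 ⊆ 𝒰) (hfin : 𝓕.Finite)
    (h : FinitelyCovered 𝒰 (A \ ⋃₀ 𝓕)) : FinitelyCovered 𝒰 A := by
  obtain ⟨F, hF, hF', hFA⟩ := h.union ⟨𝓕, h𝓕, hfin, subset_rfl⟩
  exact ⟨F, hF, hF', (Set.subset_sdiff_union A _).trans hFA⟩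

/-- A disconnected cut splits into two with fewer boundary edges, one of which is again not finitely
covered. -/
theorem exists_connectedSet_not_finitelyCovered (hG : G.Connected) {𝒰 : Set (Set V)}
    (hA : IsCut G A) (h : ¬ FinitelyCovered 𝒰 A) :
    ∃ C ⊆ A, IsCut G C ∧ ConnectedSet G C ∧ ¬ FinitelyCovered 𝒰 C := by
  induction hn : capacity (fun _ : G.edgeSet => 1) A using Nat.strong_induction_on
    generalizing A with
  | _ n ih =>
    by_cases hconn : ConnectedSet G A
    · exact ⟨A, subset_rfl, hA, hconn, h⟩
    obtain ⟨B, C, rfl, hB, hC, hBc, hCc⟩ := hA.exists_split (fun _ => 1) hG hconn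
    rw [hn] at hBc hCc
    by_cases h' : FinitelyCovered 𝒰 B
    · obtain ⟨D, hD, hD'⟩ := ih _ hCc hC (fun h'' => h (h'.union h'')) rfl
      exact ⟨D, hD.trans Set.subset_union_right, hD'⟩
    · obtain ⟨D, hD, hD'⟩ := ih _ hBc hB h' rfl
      exact ⟨D, hD.trans Set.subset_union_left, hD'⟩

/-- If every vertex and every end in the cut `A` lies in a member of the set of cuts `𝒰`, then
finitely many members of `𝒰` cover `A`. -/
theorem IsCut.finitelyCovered (hG : G.Connected) (hA : IsCut G A) {𝒰 : Set (Set V)}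
    (h𝒰 : ∀ E ∈ 𝒰, IsCut G E)
    (h : ∀ p : V ⊕ EdgeEnd G, LiesIn A p → ∃ E ∈ 𝒰, LiesIn E p) : FinitelyCovered 𝒰 A := by
  by_contra hcov
  have hAne : A.Nonempty := by
    by_contra hA'
    rw [Set.not_nonempty_iff_eq_empty] at hA'
    exact hcov ⟨∅, Set.empty_subset _, Set.finite_empty, by simp [hA']⟩
  let S := {C : Set V // C ⊆ A ∧ IsCut G C ∧ ConnectedSet G C ∧ ¬ FinitelyCovered 𝒰 C}
  -- Removing finitely many members of `𝒰` that cover `F` leaves a cut that is still not finitely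
  -- covered; a connected piece of it is kept.
  have shrink : ∀ C ⊆ A, IsCut G C → ¬ FinitelyCovered 𝒰 C → ∀ F : Set V, F.Finite → F ⊆ A →
      ∃ D : S, D.1 ⊆ C ∧ Disjoint F D.1 := by
    intro C hCA hC hcov F hF hFA
    have : ∀ x : F, ∃ E ∈ 𝒰, x.1 ∈ E := fun x => h (Sum.inl x.1) (hFA x.2)
    choose E hE hxE using this
    have hFfin := hF.to_subtype
    have hsub : Set.range E ⊆ 𝒰 := Set.range_subset_iff.2 hE
    have hcut := IsCut.sUnion (Set.finite_range E) fun D hD => h𝒰 D (hsub hD)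
    obtain ⟨D, hD, hDcut, hDconn, hDcov⟩ := exists_connectedSet_not_finitelyCovered hG
      (hC.diff hcut) (fun h => hcov (h.of_diff hsub (Set.finite_range E)))
    refine ⟨⟨D, (hD.trans Set.sdiff_subset).trans hCA, hDcut, hDconn, hDcov⟩,
      hD.trans Set.sdiff_subset, ?_⟩
    rw [Set.disjoint_left]
    intro x hx hxD
    exact (hD hxD).2 (Set.mem_sUnion.2 ⟨_, ⟨⟨x, hx⟩, rfl⟩, hxE ⟨x, hx⟩⟩)
  obtain ⟨r, hr⟩ := hAne
  obtain ⟨C₀, -, hrC⟩ := shrink A subset_rfl hA hcov {r} (Set.finite_singleton r)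
    (Set.singleton_subset_iff.2 hr)
  have step : ∀ C : S, ∃ D : S, D.1 ⊆ C.1 ∧ Disjoint (boundaryVertices G C.1 ∩ C.1) D.1 :=
    fun C => shrink C.1 C.2.1 C.2.2.1 C.2.2.2.2 _ (C.2.2.1.finite_boundaryVertices.inter_of_left _)
      (Set.inter_subset_right.trans C.2.1)
  choose next hnext hdisj using step
  let C : ℕ → S := fun n => next^[n] C₀
  have C_succ : ∀ n, C (n + 1) = next (C n) := fun n => Function.iterate_succ_apply' _ _ _
  have hanti : Antitone fun n => (C n).1 := antitone_nat_of_succ_le fun n => by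
    rw [C_succ]
    exact hnext _
  have hne : ∀ n, (C n).1.Nonempty := by
    intro n
    by_contra h'
    rw [Set.not_nonempty_iff_eq_empty] at h'
    exact (C n).2.2.2.2 ⟨∅, Set.empty_subset _, Set.finite_empty, by simp [h']⟩
  -- The intersection omits `r`, so if nonempty it is left by an edge `wz`. Then `w` is a boundary
  -- vertex of some `C n` containing it, and was discarded in passing to `C (n + 1)`.
  have hempty : ∀ x, ∃ n, x ∉ (C n).1 := by
    by_contra! hx
    obtain ⟨x, hx⟩ := hx
    obtain ⟨w, hw, z, hz, hwz⟩ := exists_adj_of_ne_univ (A := ⋂ n, (C n).1) hG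
      ⟨x, Set.mem_iInter.2 hx⟩ ((Set.ne_univ_iff_exists_notMem _).2
        ⟨r, fun h => Set.disjoint_left.1 hrC rfl (Set.mem_iInter.1 h 0)⟩)
    obtain ⟨n, hn⟩ : ∃ n, z ∉ (C n).1 := by simpa using hz
    rw [Set.mem_iInter] at hw
    have h1 := hw (n + 1)
    rw [C_succ] at h1
    exact Set.disjoint_left.1 (hdisj (C n)) ⟨⟨z, hwz, by simp [hw n, hn]⟩, hw n⟩ h1
  obtain ⟨R, hR⟩ := exists_ray_of_antitone hanti hne (fun n => (C n).2.2.2.1) hempty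
  have hRA : LiesIn A (Sum.inr (Quotient.mk (raySetoid G) R)) := by
    rw [liesIn_inr_mk hA]
    filter_upwards [hR 0] with n hn
    exact (C 0).2.1 hn
  obtain ⟨E, hE, hRE⟩ := h _ hRA
  rw [liesIn_inr_mk (h𝒰 E hE)] at hRE
  -- The finitely many boundary vertices of `E` all drop out, so some `C N` lies on one side of `E`.
  -- Inside `E` it would be covered by one set; outside, the ray could not end in `E`.
  obtain ⟨N, hN⟩ : ∃ N, ∀ x ∈ boundaryVertices G E, x ∉ (C N).1 := by
    choose m hm using hempty
    obtain ⟨N, hN⟩ := ((h𝒰 E hE).finite_boundaryVertices.image m).bddAbove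
    exact ⟨N, fun x hx h => hm x (hanti (hN ⟨x, hx, rfl⟩) h)⟩
  rcases (C N).2.2.2.1.subset_or_subset_compl_of_disjoint hN with h' | h'
  · exact (C N).2.2.2.2 ⟨{E}, Set.singleton_subset_iff.2 hE, Set.finite_singleton E, by simpa⟩
  · obtain ⟨n, h1, h2⟩ := ((hR N).and hRE).exists
    exact h' h1 h2

end Compactness

/-! ### Generation of the Boolean ring by a stage. -/

section GeneratedRing

variable {𝒮 : Set (Set V)}

theorem univ_mem_generatedRing : toBoolRing (Set.univ : Set V) ∈ generatedRing 𝒮 :=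
  Subring.one_mem _

theorem empty_mem_generatedRing : toBoolRing (∅ : Set V) ∈ generatedRing 𝒮 :=
  Subring.zero_mem _

theorem inter_mem_generatedRing (hA : toBoolRing A ∈ generatedRing 𝒮)
    (hB : toBoolRing B ∈ generatedRing 𝒮) : toBoolRing (A ∩ B) ∈ generatedRing 𝒮 :=
  Subring.mul_mem _ hA hB

theorem compl_mem_generatedRing (hA : toBoolRing A ∈ generatedRing 𝒮) :
    toBoolRing Aᶜ ∈ generatedRing 𝒮 := by
  have h : toBoolRing Aᶜ = toBoolRing Set.univ + toBoolRing A := by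
    have : Aᶜ = symmDiff Set.univ A := by
      rw [← Set.top_eq_univ, top_symmDiff, hnot_eq_compl]
    rw [this]
    rfl
  rw [h]
  exact Subring.add_mem _ univ_mem_generatedRing hA

theorem union_mem_generatedRing (hA : toBoolRing A ∈ generatedRing 𝒮)
    (hB : toBoolRing B ∈ generatedRing 𝒮) : toBoolRing (A ∪ B) ∈ generatedRing 𝒮 := by
  rw [← compl_compl (A ∪ B), Set.compl_union]
  exact compl_mem_generatedRing
    (inter_mem_generatedRing (compl_mem_generatedRing hA) (compl_mem_generatedRing hB))

theorem mem_generatedRing (hA : A ∈ 𝒮) : toBoolRing A ∈ generatedRing 𝒮 :=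
  Subring.subset_closure (Set.mem_image_of_mem _ hA)

theorem sUnion_mem_generatedRing {𝓕 : Set (Set V)} (hf : 𝓕.Finite) (h : 𝓕 ⊆ 𝒮) :
    toBoolRing (⋃₀ 𝓕) ∈ generatedRing 𝒮 := by
  induction 𝓕, hf using Set.Finite.induction_on with
  | empty => simpa using empty_mem_generatedRing
  | insert _ _ ih =>
    rw [Set.sUnion_insert]
    rw [Set.insert_subset_iff] at h
    exact union_mem_generatedRing (mem_generatedRing h.1) (ih h.2)

theorem mem_generatedRing_of_finitelyCovered
    (h : FinitelyCovered {E ∈ 𝒮 | E ⊆ A} A) : toBoolRing A ∈ generatedRing 𝒮 := by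
  obtain ⟨F, hF, hF', hFA⟩ := h
  rw [hFA.antisymm (Set.sUnion_subset fun E hE => (hF hE).2)]
  exact sUnion_mem_generatedRing hF' fun E hE => (hF hE).1

theorem mem_generatedRing_of_nested (hG : G.Connected) {n : ℕ} (hA : IsCut G A)
    (hn : capacity c A ≤ n) (hnest : ∀ E ∈ stage c n, Nested A E) :
    toBoolRing A ∈ generatedRing (stage c n) := by
  have hcut : ∀ {E}, E ∈ stage c n → IsCut G E := fun hE => (isBond_of_mem_stage hG hE).isCut
  by_contra h
  have key : ∀ A, IsCut G A → toBoolRing A ∉ generatedRing (stage c n) →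
      ∃ p : V ⊕ EdgeEnd G, LiesIn A p ∧ ∀ E ∈ stage c n, E ⊆ A → ¬ LiesIn E p := by
    intro A hA h
    by_contra! hp
    refine h (mem_generatedRing_of_finitelyCovered
      (hA.finitelyCovered hG (fun E hE => hcut hE.1) fun p hpA => ?_))
    obtain ⟨E, hE, hEA, hEp⟩ := hp p hpA
    exact ⟨E, ⟨hE, hEA⟩, hEp⟩
  obtain ⟨p, hpA, hp⟩ := key A hA h
  obtain ⟨q, hqA, hq⟩ := key Aᶜ hA.compl fun h' => h (by simpa using compl_mem_generatedRing h')
  obtain ⟨E, hE, -, hpq, -⟩ := exists_mem_stage_isThinFor hG hA (Or.inl ⟨hpA, hqA⟩) hn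
  -- Each way of being nested either puts `p` or `q` on the wrong side of `E`, or gives `E ⊆ A` or
  -- `Eᶜ ⊆ Aᶜ`, against the choice of `p` or `q`.
  have final : ∀ E ∈ stage c n, LiesIn E p → LiesIn Eᶜ q → False := by
    intro E hE hEp hEq
    rw [liesIn_compl (hcut hE)] at hEq
    rw [liesIn_compl hA] at hqA
    rcases nested_iff.1 (hnest E hE) with h1 | h1 | h1 | h1
    · exact (liesIn_compl (hcut hE) p).1 (liesIn_mono h1 hpA) hEp
    · exact hp E hE h1 hEp
    · exact hq Eᶜ (compl_mem_stage hE) (Set.compl_subset_compl.2 h1)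
        ((liesIn_compl (hcut hE) q).2 hEq)
    · exact hEq (liesIn_mono h1 ((liesIn_compl hA q).2 hqA))
  rcases hpq with h1 | h1
  · exact final E hE h1.1 h1.2
  · exact final Eᶜ (compl_mem_stage hE) h1.1 (by rw [compl_compl]; exact h1.2)

/-- Induction on the number of members crossing `A`. If `E` is one, then on each side of `E` one of
the two corners with `A` and `Aᶜ` costs no more than `A` and crosses fewer members. It is in the
ring by induction, and so is the other, its complement within that side. -/
theorem mem_generatedRing_stage (hG : G.Connected) {n : ℕ} (hA : IsCut G A)
    (hn : capacity c A ≤ n) : toBoolRing A ∈ generatedRing (stage c n) := by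
  induction hk : {C ∈ stage c n | ¬ Nested A C}.ncard using Nat.strong_induction_on
    generalizing A with
  | _ k ih =>
    by_cases h0 : ∀ C ∈ stage c n, Nested A C
    · exact mem_generatedRing_of_nested hG hA hn h0
    push Not at h0
    obtain ⟨E, hE, hAE⟩ := h0
    have hf : {C ∈ stage c n | ¬ Nested A C}.Finite :=
      finite_crossing_of_subset (n := n) hG hA fun B hB => exists_isThinFor_of_mem_stage hB
    have corner : ∀ A' E', IsCut G A' →
        {C ∈ stage c n | ¬ Nested A' C} = {C ∈ stage c n | ¬ Nested A C} →
        E' ∈ stage c n → ¬ Nested A' E' → capacity c (A' ∩ E') ≤ capacity c A →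
        toBoolRing (A' ∩ E') ∈ generatedRing (stage c n) := by
      intro A' E' hA' hcross hE' hAE' hle
      refine ih _ ?_ (hA'.inter (isBond_of_mem_stage hG hE').isCut) (hle.trans hn) rfl
      rw [← hk]
      refine Set.ncard_lt_ncard ?_ hf
      rw [← hcross]
      refine ⟨fun C ⟨hC, h⟩ => ⟨hC, fun h' => h (Nested.inter hAE' h' ?_)⟩, fun h => ?_⟩
      · exact nested_of_mem_stage hG n E' hE' C hC
      · exact (h ⟨hE', hAE'⟩).2 (nested_inter_right A' E')
    have half : ∀ E' ∈ stage c n, ¬ Nested A E' →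
        toBoolRing (A ∩ E') ∈ generatedRing (stage c n) := by
      intro E' hE' hAE'
      obtain ⟨⟨x, y, hxy⟩, -⟩ := exists_isThinFor_of_mem_stage hE'
      rcases hxy.capacity_inter_le hA with h | h
      · exact corner A E' hA rfl hE' hAE' h
      · have h1 := corner Aᶜ E' hA.compl (by simp only [nested_compl_left]) hE'
          (by rwa [nested_compl_left]) h
        have h2 := inter_mem_generatedRing (mem_generatedRing hE') (compl_mem_generatedRing h1)
        have h3 : E' ∩ (Aᶜ ∩ E')ᶜ = A ∩ E' := by
          ext z
          simp only [Set.mem_inter_iff, Set.mem_compl_iff]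
          tauto
        rwa [h3] at h2
    have h1 := half E hE hAE
    have h2 := half Eᶜ (compl_mem_stage hE) (by rwa [nested_compl_right])
    rw [← Set.inter_union_compl A E]
    exact union_mem_generatedRing h1 h2

theorem generatedRing_stage (hG : G.Connected) (c : G.edgeSet → ℕ+) (n : ℕ) :
    generatedRing (stage c n) = generatedRing {A : Set V | IsCut G A ∧ capacity c A ≤ n} := by
  apply le_antisymm
  · refine Subring.closure_mono (Set.image_mono fun A hA => ?_)
    exact ⟨(isBond_of_mem_stage hG hA).isCut, (exists_isThinFor_of_mem_stage hA).2⟩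
  · refine Subring.closure_le.2 ?_
    rintro _ ⟨A, ⟨hA, hn⟩, rfl⟩
    exact mem_generatedRing_stage hG hA hn

end GeneratedRing

end CutTree

theorem mainTheorem6 {V : Type*} (G : SimpleGraph V) (hG : G.Connected) (c : G.edgeSet → ℕ+) :
    (∀ u v : V ⊕ CutTree.EdgeEnd G,
      (∃ A : Set V, CutTree.IsCut G A ∧ CutTree.Separates A u v) →
        ∃ A ∈ CutTree.allStages c, CutTree.IsThinFor c A u v) ∧
    ∀ n : ℕ,
      CutTree.generatedRing (CutTree.stage c n) =
        CutTree.generatedRing {A : Set V | CutTree.IsCut G A ∧ CutTree.capacity c A ≤ n} ∧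
      CutTree.IsDirectedEdgeSetOfTree (CutTree.stage c n) := by
  refine ⟨fun u v ⟨A, hA, hs⟩ => ?_, fun n => ⟨CutTree.generatedRing_stage hG c n,
    CutTree.isDirectedEdgeSetOfTree_stage hG c n⟩⟩
  obtain ⟨B, hB, hB'⟩ := CutTree.exists_mem_stage_isThinFor hG hA hs le_rfl
  exact ⟨B, Set.mem_iUnion.2 ⟨_, hB⟩, hB'⟩
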